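/- Let $(M,\omega)$ be a closed symplectic manifold with a smooth almost complex structure $J$ such that $g(u,v)=\omega(u,Jv)$ is a Riemannian metric, with Levi-Civita connection $\nabla$. Let $G$ be a compact connected Abelian Lie group acting smoothly on $M$, preserving $\omega$ and $J$ (hence $g$), in a Hamiltonian way with equivariant moment map $\mu:M\to\mathfrak g^*$. Give $\mathfrak g$ (hence $\mathfrak g^*$) an $\mathrm{Ad}\,G$-invariant inner product, let $h_1,\dots,h_{\dim G}$ be an orthonormal basis of $\mathfrak g^*$, write $\mu=\sum_i\mu_ih_i$, and let $V_i$ be the vector field on $M$ generated by the $i$-th element of the dual basis; the convention is $\iota_{V_i}\omega=d\mu_i$. Let $\mathcal H=|\mu|^2=\sum_i\mu_i^2$ and let $X^{\mathcal H}$ be its Hamiltonian vector field, $\iota_{X^{\mathcal H}}\omega=d\mathcal H$, i.e. $X^{\mathcal H}=-J(d\mathcal H)^*$. For a real tangent vector $X$ write $X=X_1+X_2$ with $X_1\in T^{(1,0)}M$, $X_2\in T^{(0,1)}M$, the $\pm\sqrt{-1}$-eigenspaces of $J$ on $TM\otimes\mathbb C$. Let $\overline X_1^*\in T^{(0,1)*}M$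 and $\overline X_2^*\in T^{(1,0)*}M$ be the duals of $X_1$, $X_2$ with respect to the complex bilinear extension of $g$. On $\wedge^{p,*}(T^*M)=\wedge^p(T^{(1,0)*}M)\otimes\wedge^*(T^{(0,1)*}M)$ let $$c(X)=\sqrt2\,\overline X_1^*\wedge-\sqrt2\,i_{X_2}\ \text{ (acting on the second factor)},\qquad A(X,Y)=\overline X_2^*\wedge i_{Y_1}\ \text{ (acting on the first factor)}.$$ Let $\nabla^{T^{(1,0)}M}$ be the connection on $T^{(1,0)}M$ obtained by projecting $\nabla$, and let $\mathrm{Tr}[\nabla^{T^{(1,0)}M}X^{\mathcal H}]$ be the complex trace of the endomorphism $Z\mapsto\nabla^{T^{(1,0)}M}_Z(X^{\mathcal H})_1$ of $T^{(1,0)}M$. Let $x\in M\setminus\mu^{-1}(0)$ be a critical point of $\mathcal H$. Let $e_1,\dots,e_{\dim M}$ be an orthonormal basis of $T_xM$, and $y=(y_1,\dots,y_{\dim M})$ smooth local coordinates centred at $x$ with $\partial/\partial y_j=e_j$ at $x$ (for instance the normal coordinates defined by $e_1,\dots,e_{\dim M}$), such that near $x$ $$\mathcal H(y)=\mathcal H(x)+\sum_{j=1}^{\dim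 M}a_jy_j^2+O(|y|^3)$$ with real numbers $a_j$, possibly zero. Then for every integer $p\ge0$ and every Hermitian vector space $W$ (such as the fibre at $x$ of a Hermitian coefficient bundle $E$), the following endomorphism of $\wedge^{p,*}(T_x^*M)\otimes W$ (acting as the identity on $W$) is Hermitian for the induced metric and satisfies $$\begin{aligned}&\frac{\sqrt{-1}}4\sum_{j=1}^{\dim M}\Big(c(e_j)\,c\big(\nabla_{e_j}X^{\mathcal H}\big)+4A\big(e_j,\nabla_{e_j}X^{\mathcal H}\big)\Big)-\frac{\sqrt{-1}}2\mathrm{Tr}\big[\nabla^{T^{(1,0)}M}X^{\mathcal H}\big]\\&\quad+\frac12\sum_{i=1}^{\dim G}\Big(\sqrt{-1}\,c(JV_i)c(V_i)+|V_i|^2-4\sqrt{-1}A(JV_i,V_i)\Big)\ \ge\ -\sum_{j=1}^{\dim M}|a_j|\end{aligned}$$ at $x$, where $T\ge c$ means $\langle Ts,s\rangle\ge c\langle s,s\rangle$ for all $s$. -/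

import Mathlib

open Bundle
open scoped Manifold ContDiff TensorProduct Topology

namespace SpincBochner

noncomputable section LinearAlgebra

/-! ### Hermitian linear algebra on one tangent space

`V` is a real inner product space with a linear map `J` such that `J² = -1`.  In the theorem it is
the tangent space `T_x M`. -/

variable {V : Type*} [NormedAddCommGroup V] [InnerProductSpace ℝ V]

/-- `T^{(1,0)} = {z ∈ V ⊗ ℂ : J z = √-1 z}`. -/
def T10 (J : V →ₗ[ℝ] V) : Submodule ℂ (ℂ ⊗[ℝ] V) :=
  Module.End.eigenspace (J.baseChange ℂ) Complex.I

/-- `T^{(0,1)} = {z ∈ V ⊗ ℂ : J z = -√-1 z}`. -/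
def T01 (J : V →ₗ[ℝ] V) : Submodule ℂ (ℂ ⊗[ℝ] V) :=
  Module.End.eigenspace (J.baseChange ℂ) (-Complex.I)

theorem baseChange_sq {J : V →ₗ[ℝ] V} (hJ : ∀ v, J (J v) = -v) (z : ℂ ⊗[ℝ] V) :
    J.baseChange ℂ (J.baseChange ℂ z) = -z := by
  induction z using TensorProduct.induction_on with
  | zero => simp
  | tmul c v => simp [hJ, TensorProduct.tmul_neg]
  | add x y hx hy => rw [map_add, map_add, hx, hy, neg_add]

/-- The projection `V ⊗ ℂ → T^{(1,0)}` along `T^{(0,1)}`, `z ↦ (z - √-1 J z) / 2`. -/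
def proj10 (J : V →ₗ[ℝ] V) (hJ : ∀ v, J (J v) = -v) : ℂ ⊗[ℝ] V →ₗ[ℂ] T10 J :=
  LinearMap.codRestrict (T10 J)
    ((1 / 2 : ℂ) • (LinearMap.id - Complex.I • J.baseChange ℂ)) fun z => by
      rw [T10, Module.End.mem_eigenspace_iff]
      simp only [LinearMap.smul_apply, LinearMap.sub_apply, LinearMap.id_apply, map_smul, map_sub,
        baseChange_sq hJ, smul_sub, smul_neg, smul_smul, sub_neg_eq_add]
      rw [show Complex.I * (1 / 2 * Complex.I) = -(1 / 2) by
        linear_combination (1 / 2 : ℂ) * Complex.I_mul_I, mul_comm Complex.I (1 / 2 : ℂ)]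
      module

/-- The projection `V ⊗ ℂ → T^{(0,1)}` along `T^{(1,0)}`, `z ↦ (z + √-1 J z) / 2`. -/
def proj01 (J : V →ₗ[ℝ] V) (hJ : ∀ v, J (J v) = -v) : ℂ ⊗[ℝ] V →ₗ[ℂ] T01 J :=
  LinearMap.codRestrict (T01 J)
    ((1 / 2 : ℂ) • (LinearMap.id + Complex.I • J.baseChange ℂ)) fun z => by
      rw [T01, Module.End.mem_eigenspace_iff]
      simp only [LinearMap.smul_apply, LinearMap.add_apply, LinearMap.id_apply, map_smul, map_add,
        baseChange_sq hJ, smul_add, smul_neg, smul_smul]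
      rw [show -Complex.I * (1 / 2 * Complex.I) = 1 / 2 by
        linear_combination (-1 / 2 : ℂ) * Complex.I_mul_I]
      module

/-- The component `X₁ ∈ T^{(1,0)}` of a real vector `X = X₁ + X₂`. -/
def part10 (J : V →ₗ[ℝ] V) (hJ : ∀ v, J (J v) = -v) (X : V) : T10 J := proj10 J hJ (1 ⊗ₜ[ℝ] X)

/-- The component `X₂ ∈ T^{(0,1)}` of a real vector `X = X₁ + X₂`. -/
def part01 (J : V →ₗ[ℝ] V) (hJ : ∀ v, J (J v) = -v) (X : V) : T01 J := proj01 J hJ (1 ⊗ₜ[ℝ] X)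

/-- The complex bilinear extension of the metric to `V ⊗ ℂ`. -/
def metricC (V : Type*) [NormedAddCommGroup V] [InnerProductSpace ℝ V] :
    LinearMap.BilinForm ℂ (ℂ ⊗[ℝ] V) :=
  LinearMap.BilinForm.baseChange ℂ (innerₗ V)

/-- The metric dual of `X₁`, as an element of the dual of `T^{(0,1)}`. -/
def dual01 (J : V →ₗ[ℝ] V) (hJ : ∀ v, J (J v) = -v) (X : V) : Module.Dual ℂ (T01 J) :=
  metricC V (part10 J hJ X : ℂ ⊗[ℝ] V) ∘ₗ (T01 J).subtype

/-- The metric dual of `X₂`, as an element of the dual of `T^{(1,0)}`. -/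
def dual10 (J : V →ₗ[ℝ] V) (hJ : ∀ v, J (J v) = -v) (X : V) : Module.Dual ℂ (T10 J) :=
  metricC V (part01 J hJ X : ℂ ⊗[ℝ] V) ∘ₗ (T10 J).subtype

section Forms

variable {U N : Type*} [AddCommGroup U] [Module ℂ U] [AddCommGroup N] [Module ℂ N]

/-- Exterior multiplication by a `1`-form,
`(α ∧ s)(u₀, …, uₙ) = ∑ₖ (-1)ᵏ α(uₖ) s(u₀, …, ûₖ, …, uₙ)`. -/
def wedgeForm (α : Module.Dual ℂ U) (n : ℕ) :
    (U [⋀^Fin n]→ₗ[ℂ] N) →ₗ[ℂ] (U [⋀^Fin (n + 1)]→ₗ[ℂ] N) :=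
  AlternatingMap.alternatizeUncurryFinLM ∘ₗ LinearMap.smulRightₗ α

/-- Interior multiplication, `(i_u s)(u₁, …, uₙ) = s(u, u₁, …, uₙ)`. -/
def contractForm (u : U) (n : ℕ) :
    (U [⋀^Fin (n + 1)]→ₗ[ℂ] N) →ₗ[ℂ] (U [⋀^Fin n]→ₗ[ℂ] N) :=
  LinearMap.applyₗ u ∘ₗ AlternatingMap.curryLeftLinearMap

end Forms

/-- `Λ^{0,*} ⊗ W`: the components are the alternating `ℂ`-multilinear forms on `T^{(0,1)}` with
values in `W`, one component for each degree (those of degree above `dim_ℂ V` vanish). -/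
abbrev Forms0 (J : V →ₗ[ℝ] V) (W : Type*) [AddCommGroup W] [Module ℂ W] : Type _ :=
  (q : ℕ) → (T01 J) [⋀^Fin q]→ₗ[ℂ] W

/-- `Λ^{p,*} ⊗ W = Λ^{p,0} ⊗ Λ^{0,*} ⊗ W`: alternating `ℂ`-multilinear `p`-forms on `T^{(1,0)}` with
values in `Λ^{0,*} ⊗ W`. -/
abbrev FormsP (J : V →ₗ[ℝ] V) (p : ℕ) (W : Type*) [AddCommGroup W] [Module ℂ W] : Type _ :=
  (T10 J) [⋀^Fin p]→ₗ[ℂ] Forms0 J W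

section Operators

variable (J : V →ₗ[ℝ] V) (hJ : ∀ v, J (J v) = -v)
  (W : Type*) [AddCommGroup W] [Module ℂ W]

/-- Exterior multiplication by the metric dual of `X₁` on `Λ^{0,*} ⊗ W`. -/
def wedge0 (X : V) : Module.End ℂ (Forms0 J W) :=
  LinearMap.pi fun q => match q with
    | 0 => 0
    | r + 1 => wedgeForm (dual01 J hJ X) r ∘ₗ LinearMap.proj r

/-- Interior multiplication by `X₂` on `Λ^{0,*} ⊗ W`. -/
def contract0 (X : V) : Module.End ℂ (Forms0 J W) :=
  LinearMap.pi fun q => contractForm (part01 J hJ X) q ∘ₗ LinearMap.proj (q + 1)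

/-- The Clifford action of `X` on `Λ^{0,*} ⊗ W`: `√2` times exterior multiplication by the metric
dual of `X₁`, minus `√2` times interior multiplication by `X₂`. -/
def clifford0 (X : V) : Module.End ℂ (Forms0 J W) :=
  ((Real.sqrt 2 : ℝ) : ℂ) • wedge0 J hJ W X - ((Real.sqrt 2 : ℝ) : ℂ) • contract0 J hJ W X

/-- The Clifford action `c(X)` on `Λ^{p,*} ⊗ W`, trivial on the factor `Λ^{p,0}`. -/
def clifford (p : ℕ) (X : V) : Module.End ℂ (FormsP J p W) where
  toFun s := (clifford0 J hJ W X).compAlternatingMap s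
  map_add' s t := by ext; simp
  map_smul' c s := by ext; simp

/-- `A(X, Y)` on `Λ^{p,*} ⊗ W`: interior multiplication by `Y₁` followed by exterior multiplication
by the metric dual of `X₂`, on the factor `Λ^{p,0}`. -/
def opA (p : ℕ) (X Y : V) : Module.End ℂ (FormsP J p W) :=
  match p with
  | 0 => 0
  | r + 1 => wedgeForm (dual10 J hJ X) r ∘ₗ contractForm (part10 J hJ Y) r

/-- The trace over `T^{(1,0)}` of `Z ↦ ∇_Z^{T^{(1,0)}} V₁`, where `V₁ = (V - √-1 J V) / 2` is the
`(1,0)`-component of a vector field `V`, `D = ∇V` and `DJ = ∇(JV)`, and where the connection on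
`T^{(1,0)}` is the projection of `∇` to `T^{(1,0)}`. -/
def trace10 (D DJ : V →ₗ[ℝ] V) : ℂ :=
  LinearMap.trace ℂ (T10 J)
    (proj10 J hJ ∘ₗ
      ((1 / 2 : ℂ) • (D.baseChange ℂ - Complex.I • DJ.baseChange ℂ)) ∘ₗ (T10 J).subtype)

end Operators

section Metric

variable [FiniteDimensional ℝ V] (J : V →ₗ[ℝ] V) (hJ : ∀ v, J (J v) = -v)
  {W : Type*} [NormedAddCommGroup W] [InnerProductSpace ℂ W]

/-- The induced Hermitian metric on `Λ^{0,*} ⊗ W`, complex linear in the second variable.  If `z_a`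
is a unitary frame of `T^{(0,1)}`, it is the sum over degrees `q` and over increasing indices
`a₁ < … < a_q` of `⟪s(z_{a₁}, …, z_{a_q}), t(z_{a₁}, …, z_{a_q})⟫`, that is, `1 / q!` times the sum
over all indices; and the sum over a unitary frame of `T^{(0,1)}` is the sum over the
`(0,1)`-components of a real orthonormal frame `e_b` of `V`, because `∑ₐ conj(z_a) ⊗ z_a` equals
`∑_b conj(e_b^{0,1}) ⊗ e_b^{0,1}`. -/
def herm0 (s t : Forms0 J W) : ℂ :=
  ∑ q ∈ Finset.range (Module.finrank ℝ V + 1), ((q.factorial : ℂ))⁻¹ *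
    ∑ b : Fin q → Fin (Module.finrank ℝ V),
      inner ℂ (s q fun i => part01 J hJ (stdOrthonormalBasis ℝ V (b i)))
        (t q fun i => part01 J hJ (stdOrthonormalBasis ℝ V (b i)))

/-- The induced Hermitian metric on `Λ^{p,*} ⊗ W`, in the same way. -/
def herm (p : ℕ) (s t : FormsP J p W) : ℂ :=
  ((p.factorial : ℂ))⁻¹ * ∑ a : Fin p → Fin (Module.finrank ℝ V),
    herm0 J hJ (s fun i => part10 J hJ (stdOrthonormalBasis ℝ V (a i)))
      (t fun i => part10 J hJ (stdOrthonormalBasis ℝ V (a i)))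

/-- `T ≥ c` for an endomorphism `T` of `Λ^{p,*} ⊗ W` and a real number `c`: `T` is Hermitian and
`⟪T s, s⟫ ≥ c ⟪s, s⟫` for all `s`. -/
def BoundedBelow (p : ℕ) (T : Module.End ℂ (FormsP J p W)) (c : ℝ) : Prop :=
  (∀ s t, herm J hJ p (T s) t = herm J hJ p s (T t)) ∧
    ∀ s, c * (herm J hJ p s s).re ≤ (herm J hJ p (T s) s).re

end Metric

end LinearAlgebra

noncomputable section Geometry

/-! ### Symplectic manifolds, almost complex structures and Hamiltonian actions -/

variable {m k : ℕ}
  {M : Type*} [TopologicalSpace M] [ChartedSpace (EuclideanSpace ℝ (Fin m)) M]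

instance finiteDimensional_tangentSpace (x : M) : FiniteDimensional ℝ (TangentSpace (𝓡 m) x) :=
  inferInstanceAs (FiniteDimensional ℝ (EuclideanSpace ℝ (Fin m)))

instance isContMDiffRiemannianBundle_one [IsManifold (𝓡 m) ∞ M]
    [RiemannianBundle (fun x : M => TangentSpace (𝓡 m) x)]
    [IsContMDiffRiemannianBundle (𝓡 m) ∞ (EuclideanSpace ℝ (Fin m))
      (fun x : M => TangentSpace (𝓡 m) x)] :
    IsContMDiffRiemannianBundle (𝓡 m) 1 (EuclideanSpace ℝ (Fin m))
      (fun x : M => TangentSpace (𝓡 m) x) :=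
  IsContMDiffRiemannianBundle.of_le (n := ∞) (by norm_cast)

/-- `Ω` is a symplectic form: a smooth, closed, nondegenerate `2`-form.  Closedness is expressed
by Cartan's formula for `dΩ` on smooth vector fields. -/
structure IsSymplecticForm [IsManifold (𝓡 m) ∞ M]
    (Ω : Π x : M, TangentSpace (𝓡 m) x →L[ℝ] TangentSpace (𝓡 m) x →L[ℝ] ℝ) : Prop where
  contMDiff : ContMDiff (𝓡 m)
    ((𝓡 m).prod 𝓘(ℝ, EuclideanSpace ℝ (Fin m) →L[ℝ] EuclideanSpace ℝ (Fin m) →L[ℝ] ℝ)) ∞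
    (fun x => TotalSpace.mk' (EuclideanSpace ℝ (Fin m) →L[ℝ] EuclideanSpace ℝ (Fin m) →L[ℝ] ℝ)
      (E := fun x : M => TangentSpace (𝓡 m) x →L[ℝ] TangentSpace (𝓡 m) x →L[ℝ] ℝ) x (Ω x))
  alternating : ∀ x v, Ω x v v = 0
  nondegenerate : ∀ x u, (∀ v, Ω x u v = 0) → u = 0
  closed : ∀ X Y Z : Π x : M, TangentSpace (𝓡 m) x,
    ContMDiff (𝓡 m) (𝓡 m).tangent ∞ (fun x => (⟨x, X x⟩ : TangentBundle (𝓡 m) M)) →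
    ContMDiff (𝓡 m) (𝓡 m).tangent ∞ (fun x => (⟨x, Y x⟩ : TangentBundle (𝓡 m) M)) →
    ContMDiff (𝓡 m) (𝓡 m).tangent ∞ (fun x => (⟨x, Z x⟩ : TangentBundle (𝓡 m) M)) →
    ∀ x, mvfderiv (𝓡 m) (fun y => Ω y (Y y) (Z y)) x (X x)
        - mvfderiv (𝓡 m) (fun y => Ω y (X y) (Z y)) x (Y x)
        + mvfderiv (𝓡 m) (fun y => Ω y (X y) (Y y)) x (Z x)
        - Ω x (VectorField.mlieBracket (𝓡 m) X Y x) (Z x)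
        + Ω x (VectorField.mlieBracket (𝓡 m) X Z x) (Y x)
        - Ω x (VectorField.mlieBracket (𝓡 m) Y Z x) (X x) = 0

/-- `J` is a smooth almost complex structure and `g(u, v) = Ω(u, J v)`, where `g` is the Riemannian
metric of `M`. -/
structure IsCompatibleAlmostComplex [IsManifold (𝓡 m) ∞ M]
    [RiemannianBundle (fun x : M => TangentSpace (𝓡 m) x)]
    (Ω : Π x : M, TangentSpace (𝓡 m) x →L[ℝ] TangentSpace (𝓡 m) x →L[ℝ] ℝ)
    (J : Π x : M, TangentSpace (𝓡 m) x →L[ℝ] TangentSpace (𝓡 m) x) : Prop where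
  contMDiff : ContMDiff (𝓡 m)
    ((𝓡 m).prod 𝓘(ℝ, EuclideanSpace ℝ (Fin m) →L[ℝ] EuclideanSpace ℝ (Fin m))) ∞
    (fun x => TotalSpace.mk' (EuclideanSpace ℝ (Fin m) →L[ℝ] EuclideanSpace ℝ (Fin m))
      (E := fun x : M => TangentSpace (𝓡 m) x →L[ℝ] TangentSpace (𝓡 m) x) x (J x))
  sq : ∀ x v, J x (J x v) = -v
  metric_eq : ∀ x (u v : TangentSpace (𝓡 m) x), inner ℝ u v = Ω x u (J x v)

/-- The Levi-Civita connection: torsion free and compatible with the metric. -/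
structure IsLeviCivita [IsManifold (𝓡 m) ∞ M]
    [RiemannianBundle (fun x : M => TangentSpace (𝓡 m) x)]
    [IsContMDiffRiemannianBundle (𝓡 m) ∞ (EuclideanSpace ℝ (Fin m))
      (fun x : M => TangentSpace (𝓡 m) x)]
    (cov : CovariantDerivative (𝓡 m) (EuclideanSpace ℝ (Fin m))
      (fun x : M => TangentSpace (𝓡 m) x)) : Prop where
  torsion_eq_zero : cov.torsion = 0
  metric : cov.IsMetricCompatible

/-- `X` is the Hamiltonian vector field of `f`: `Ω(X, ·) = df`.  If `g(u, v) = Ω(u, J v)` is a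
metric, this says `X = -J (df)^*`. -/
def IsHamiltonianVectorField
    (Ω : Π x : M, TangentSpace (𝓡 m) x →L[ℝ] TangentSpace (𝓡 m) x →L[ℝ] ℝ)
    (f : M → ℝ) (X : Π x : M, TangentSpace (𝓡 m) x) : Prop :=
  ∀ x v, Ω x (X x) v = mvfderiv (𝓡 m) f x v

variable {G : Type*} [TopologicalSpace G] [ChartedSpace (EuclideanSpace ℝ (Fin k)) G] [Group G]

/-- The adjoint action of `g` on the Lie algebra, the derivative of `h ↦ g h g⁻¹` at `1`. -/
def Ad (g : G) (ξ : GroupLieAlgebra (𝓡 k) G) : GroupLieAlgebra (𝓡 k) G :=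
  (mfderiv (𝓡 k) (𝓡 k) (fun h : G => g * h * g⁻¹) 1 ξ : EuclideanSpace ℝ (Fin k))

/-- An `Ad G`-invariant inner product on the Lie algebra. -/
structure IsAdInvariantMetric (B : LinearMap.BilinForm ℝ (GroupLieAlgebra (𝓡 k) G)) : Prop where
  symm : ∀ ξ η, B ξ η = B η ξ
  pos : ∀ ξ, ξ ≠ 0 → 0 < B ξ ξ
  invariant : ∀ (g : G) ξ η, B (Ad g ξ) (Ad g η) = B ξ η

variable [MulAction G M]

/-- The vector field on `M` generated by `ξ`, the derivative of `g ↦ g • x` at `g = 1` in the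
direction `ξ`. -/
def killingField (ξ : GroupLieAlgebra (𝓡 k) G) (x : M) : TangentSpace (𝓡 m) x :=
  (mfderiv (𝓡 k) (𝓡 m) (fun g : G => g • x) 1 ξ : EuclideanSpace ℝ (Fin m))

/-- The action of `G` preserves `Ω` and is Hamiltonian with moment map `μ : M → 𝔤^*`, and it
preserves `J` (hence also the metric `Ω(·, J ·)`). -/
structure IsHamiltonianAction
    (Ω : Π x : M, TangentSpace (𝓡 m) x →L[ℝ] TangentSpace (𝓡 m) x →L[ℝ] ℝ)
    (J : Π x : M, TangentSpace (𝓡 m) x →L[ℝ] TangentSpace (𝓡 m) x)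
    (μ : M → Module.Dual ℝ (GroupLieAlgebra (𝓡 k) G)) : Prop where
  preserves_omega : ∀ (g : G) (x : M) (u v : TangentSpace (𝓡 m) x),
    Ω (g • x) (mfderiv (𝓡 m) (𝓡 m) (fun y : M => g • y) x u)
      (mfderiv (𝓡 m) (𝓡 m) (fun y : M => g • y) x v) = Ω x u v
  preserves_J : ∀ (g : G) (x : M) (v : TangentSpace (𝓡 m) x),
    mfderiv (𝓡 m) (𝓡 m) (fun y : M => g • y) x (J x v)
      = J (g • x) (mfderiv (𝓡 m) (𝓡 m) (fun y : M => g • y) x v)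
  contMDiff_moment : ∀ ξ, ContMDiff (𝓡 m) 𝓘(ℝ, ℝ) ∞ fun x => μ x ξ
  moment : ∀ ξ, IsHamiltonianVectorField Ω (fun x => μ x ξ) (killingField ξ)
  equivariant : ∀ (g : G) (x : M) (ξ : GroupLieAlgebra (𝓡 k) G), μ (g • x) (Ad g ξ) = μ x ξ

/-- The function `|μ|² = ∑ᵢ μᵢ²`, where `μᵢ` are the components of `μ` with respect to the dual of
the orthonormal basis `b` of `𝔤`. -/
def momentNormSq {𝔤 : Type*} [AddCommGroup 𝔤] [Module ℝ 𝔤] (b : Module.Basis (Fin k) ℝ 𝔤)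
    (μ : M → Module.Dual ℝ 𝔤) (x : M) : ℝ :=
  ∑ i, μ x (b i) ^ 2

/-- `y` is a smooth local coordinate system near `x`, centred at `x`, with `∂/∂y_j = e_j` at `x`
(for instance the normal coordinates defined by the frame `e`), in which
`f = f(x) + ∑ⱼ aⱼ yⱼ² + O(|y|³)` near `x`. -/
structure HasDiagonalExpansion [RiemannianBundle (fun x : M => TangentSpace (𝓡 m) x)]
    (f : M → ℝ) (x : M) (e : OrthonormalBasis (Fin m) ℝ (TangentSpace (𝓡 m) x))
    (y : M → EuclideanSpace ℝ (Fin m)) (a : Fin m → ℝ) : Prop where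
  contMDiffAt : ContMDiffAt (𝓡 m) (𝓡 m) ∞ y x
  center : y x = 0
  frame : ∀ j, mvfderiv (𝓡 m) y x (e j) = EuclideanSpace.single j 1
  expansion : (fun z => f z - f x - ∑ j, a j * y z j ^ 2) =O[𝓝 x] fun z => ‖y z‖ ^ 3

/-- The zeroth order endomorphism
`(√-1/4) ∑ⱼ (c(eⱼ) c(∇_{eⱼ} X) + 4 A(eⱼ, ∇_{eⱼ} X)) - (√-1/2) Tr[∇^{T^{(1,0)}M} X]`
`  + (1/2) ∑ᵢ (√-1 c(J Vᵢ) c(Vᵢ) + |Vᵢ|² - 4 √-1 A(J Vᵢ, Vᵢ))`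
of `Λ^{p,*}(T^*M) ⊗ W` at `x`. -/
def bochnerTerm [IsManifold (𝓡 m) ∞ M] [RiemannianBundle (fun x : M => TangentSpace (𝓡 m) x)]
    (J : Π x : M, TangentSpace (𝓡 m) x →L[ℝ] TangentSpace (𝓡 m) x)
    (hJ : ∀ x v, J x (J x v) = -v)
    (cov : CovariantDerivative (𝓡 m) (EuclideanSpace ℝ (Fin m))
      (fun x : M => TangentSpace (𝓡 m) x))
    (X : Π x : M, TangentSpace (𝓡 m) x) (V : Fin k → Π x : M, TangentSpace (𝓡 m) x)
    (x : M) (e : OrthonormalBasis (Fin m) ℝ (TangentSpace (𝓡 m) x))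
    (p : ℕ) (W : Type*) [AddCommGroup W] [Module ℂ W] :
    Module.End ℂ (FormsP (J x).toLinearMap p W) :=
  let c := clifford (J x).toLinearMap (hJ x) W p
  let A := opA (J x).toLinearMap (hJ x) W p
  (Complex.I / 4) • ∑ j, (c (e j) * c (cov X x (e j)) + (4 : ℂ) • A (e j) (cov X x (e j)))
    - (Complex.I / 2 * trace10 (J x).toLinearMap (hJ x) (cov X x).toLinearMap
        (cov (fun z => J z (X z)) x).toLinearMap) • 1
    + (1 / 2 : ℂ) • ∑ i, (Complex.I • (c (J x (V i x)) * c (V i x))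
        + ((‖V i x‖ ^ 2 : ℝ) : ℂ) • 1
        - (4 * Complex.I) • A (J x (V i x)) (V i x))

end Geometry

end SpincBochner

open SpincBochner

/-! The statement is pointwise at `x`. Put `v i = V_i(x)` and `ξ = ∑ μ_i(x) b_i`. Nondegeneracy of
`Ω` gives `X^H = 2 ∑ μ_i V_i`, so the field `V_ξ` generated by `ξ` vanishes at the critical point.
With `L = ∇V_ξ` at `x`, the Leibniz rule yields `∇_u X^H = 2 ∑ ⟨J v_i, u⟩ v_i + 2 L u`. Three facts
control `L`. It commutes with `J`, because the action preserves `J`. The map `S = J L` is the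
Hessian of the function `μ(ξ)`, hence symmetric. Finally the image of `S` is orthogonal to every
`v_i`, because `Ω(V_ξ, V_i)` vanishes identically, the orbits of an Abelian group being isotropic.
All this is collected in `isMomentLinearization`.

Let `f_l` be an orthonormal eigenbasis of `S`, with eigenvalues `σ_l`. Computing the sum over `e_j`
in this basis (`sum_apply`), the endomorphism becomes `∑ (4 N(v_i) - |v_i|²) + ∑ σ_l (2 N(f_l) + 2
A(f_l, f_l) - 1)`, where `N(X)` is exterior multiplication after interior multiplication on the
antiholomorphic factor (`bochner_eq`). Exterior and interior multiplication are adjoint and satisfy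
the canonical anticommutation relations, so `N(X)` and `A(X, X)` are Hermitian and lie between `0`
and `|X|²/2`. Hence the endomorphism is at least `-∑ |v_i|² - ∑ |σ_l|`.

It remains to compare with the `a_j`. The Hessian of the norm square is `J ∇X^H = 2 (P + S)`, where
`P = ∑ ⟨J v_i, ·⟩ J v_i` is nonnegative of trace `∑ |v_i|²`, and its eigenvalues are `2 a_j`. Since
`S P = 0`, the trace norm of `P + S` is the sum of those of `P` and `S`; the inequality needed is
`sum_abs_le`. -/

namespace SpincBochner

/-! ### Exterior and interior multiplication of alternating forms -/

section AlternatingForms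

variable {U N : Type*} [AddCommGroup U] [Module ℂ U] [AddCommGroup N] [Module ℂ N]

theorem wedgeForm_apply (α : Module.Dual ℂ U) {n : ℕ} (s : U [⋀^Fin n]→ₗ[ℂ] N)
    (v : Fin (n + 1) → U) :
    wedgeForm α n s v = ∑ i : Fin (n + 1), (-1) ^ (i : ℕ) • α (v i) • s (i.removeNth v) := by
  simp [wedgeForm, AlternatingMap.alternatizeUncurryFin_apply]

theorem contractForm_apply (u : U) {n : ℕ} (s : U [⋀^Fin (n + 1)]→ₗ[ℂ] N) (v : Fin n → U) :
    contractForm u n s v = s (Matrix.vecCons u v) := rfl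

/-- The canonical anticommutation relation. Of the terms of `α ∧ s` on `(u, v)`, the one that feeds
`u` to `α` is the right-hand side; the others keep `u` in `s` and, their position being shifted by
one, cancel the terms of `α ∧ i_u s`. -/
theorem contractForm_wedgeForm_add (α : Module.Dual ℂ U) (u : U) {n : ℕ}
    (s : U [⋀^Fin (n + 1)]→ₗ[ℂ] N) :
    contractForm u (n + 1) (wedgeForm α (n + 1) s) + wedgeForm α n (contractForm u n s)
      = α u • s := by
  ext v
  rw [AlternatingMap.add_apply, contractForm_apply, wedgeForm_apply, wedgeForm_apply,
    Fin.sum_univ_succ, AlternatingMap.smul_apply, add_assoc, ← Finset.sum_add_distrib]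
  have h0 : (0 : Fin (n + 2)).removeNth (Matrix.vecCons u v) = v := by
    ext i; simp [Fin.removeNth]
  have h (i : Fin (n + 1)) : (i.succ).removeNth (Matrix.vecCons u v)
      = Matrix.vecCons u (i.removeNth v) := by
    ext j
    refine Fin.cases ?_ (fun j => ?_) j <;> simp [Fin.removeNth]
  rw [h0, Finset.sum_eq_zero]
  · simp
  · intro i _
    rw [h, contractForm_apply, Matrix.cons_val_succ, Fin.val_succ, pow_succ]
    simp

theorem contractForm_wedgeForm_zero (α : Module.Dual ℂ U) (u : U) (s : U [⋀^Fin 0]→ₗ[ℂ] N) :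
    contractForm u 0 (wedgeForm α 0 s) = α u • s := by
  ext v
  rw [contractForm_apply, wedgeForm_apply, AlternatingMap.smul_apply]
  simp [Subsingleton.elim _ v]

/-- The iterated product is the alternatization of the symmetric tensor `α ⊗ α` times `s`. -/
theorem wedgeForm_wedgeForm (α : Module.Dual ℂ U) {n : ℕ} (s : U [⋀^Fin n]→ₗ[ℂ] N) :
    wedgeForm α (n + 1) (wedgeForm α n s) = 0 := by
  have := AlternatingMap.alternatizeUncurryFin_alternatizeUncurryFinLM_comp_of_symmetric
    (f := LinearMap.smulRight α (LinearMap.smulRight α s)) (fun x y => by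
      simp [smul_smul, mul_comm])
  rw [← this]
  ext v
  simp [wedgeForm, AlternatingMap.alternatizeUncurryFin_apply]

theorem contractForm_contractForm (u : U) {n : ℕ} (s : U [⋀^Fin (n + 2)]→ₗ[ℂ] N) :
    contractForm u n (contractForm u (n + 1) s) = 0 := by
  ext v
  rw [contractForm_apply, contractForm_apply, AlternatingMap.zero_apply]
  exact s.map_eq_zero_of_eq _ (i := 0) (j := 1) (by simp) (by simp)

/-- The sum of `h(s(f_b), t(f_b))` over all tuples `f_b` of vectors of the frame `f`, divided by
the factorial of the degree. -/
noncomputable def frameProd {ι : Type*} [Fintype ι] (h : N → N → ℂ) (f : ι → U) (q : ℕ)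
    (s t : U [⋀^Fin q]→ₗ[ℂ] N) : ℂ :=
  ((q.factorial : ℂ))⁻¹ * ∑ b : Fin q → ι, h (s fun i => f (b i)) (t fun i => f (b i))

theorem frameProd_conj {ι : Type*} [Fintype ι] {h : N → N → ℂ}
    (hh : ∀ x y, starRingEnd ℂ (h x y) = h y x) (f : ι → U) (q : ℕ) (s t : U [⋀^Fin q]→ₗ[ℂ] N) :
    starRingEnd ℂ (frameProd h f q s t) = frameProd h f q t s := by
  simp [frameProd, hh]

/-- Exterior multiplication by `α` is adjoint to interior multiplication by the conjugate dual
vector of `α`. -/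
theorem frameProd_contractForm {ι : Type*} [Fintype ι] (h : N →ₗ⋆[ℂ] N →ₗ[ℂ] ℂ) (f : ι → U)
    (α : Module.Dual ℂ U) (u : U) (hu : ∑ b, starRingEnd ℂ (α (f b)) • f b = u) (q : ℕ)
    (s : U [⋀^Fin q]→ₗ[ℂ] N) (t : U [⋀^Fin (q + 1)]→ₗ[ℂ] N) :
    frameProd (h · ·) f (q + 1) (wedgeForm α q s) t
      = frameProd (h · ·) f q s (contractForm u q t) := by
  -- Expanding `u` in the frame turns the contraction into a sum over one more frame index, to match
  -- the tuples of length `q + 1` on the other side.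
  have hcon (v : Fin q → U) : contractForm u q t v
      = ∑ b, starRingEnd ℂ (α (f b)) • t (Matrix.vecCons (f b) v) := by
    have := t.map_update_sum Finset.univ 0 (fun b => starRingEnd ℂ (α (f b)) • f b)
      (Matrix.vecCons 0 v)
    simp only [AlternatingMap.map_update_smul] at this
    simp only [Matrix.vecCons, Fin.update_cons_zero, hu] at this
    exact this
  -- A tuple of length `q + 1` is its `k`-th entry together with the remaining tuple. Moving that
  -- entry to the front of `t` costs the sign `(-1)^k`, which cancels the sign in the wedge product,
  -- so the contribution does not depend on `k`.
  have key (k : Fin (q + 1)) :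
      ∑ b : Fin (q + 1) → ι, h ((-1) ^ (k : ℕ) • α (f (b k)) • s (k.removeNth fun i => f (b i)))
        (t fun i => f (b i))
      = ∑ b : Fin q → ι, h (s fun i => f (b i)) (contractForm u q t fun i => f (b i)) := by
    rw [← (Fin.insertNthEquiv (fun _ => ι) k).sum_comp, Fintype.sum_prod_type, Finset.sum_comm]
    refine Finset.sum_congr rfl fun b _ => ?_
    rw [hcon, map_sum]
    refine Finset.sum_congr rfl fun c _ => ?_
    have h1 : (fun i => f ((k.insertNth c b : Fin (q + 1) → ι) i))
        = (k.insertNth (f c) (fun i => f (b i)) : Fin (q + 1) → U) := by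
      ext i
      refine Fin.succAboveCases k ?_ (fun j => ?_) i <;> simp
    simp only [Fin.insertNthEquiv_apply]
    rw [h1, AlternatingMap.map_insertNth, Fin.insertNth_apply_same]
    rw [show k.removeNth (k.insertNth (f c) (fun i => f (b i)) : Fin (q + 1) → U)
      = fun i => f (b i) by simp]
    rw [← Int.cast_smul_eq_zsmul ℂ, ← Int.cast_smul_eq_zsmul ℂ]
    simp only [map_smulₛₗ, LinearMap.smul_apply, smul_eq_mul, Int.cast_pow, Int.cast_neg,
      Int.cast_one, map_pow, map_neg, map_one, RingHom.id_apply]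
    rw [← mul_assoc, ← mul_assoc, ← mul_pow]
    simp
  simp only [frameProd]
  simp only [wedgeForm_apply, map_sum, LinearMap.sum_apply]
  -- The `q + 1` equal contributions turn `1 / (q + 1)!` into `1 / q!`.
  rw [Finset.sum_comm, Finset.sum_congr rfl fun k _ => key k, Finset.sum_const, Finset.card_univ,
    Fintype.card_fin, Nat.factorial_succ, nsmul_eq_mul]
  have : ((q : ℂ) + 1) ≠ 0 := by exact_mod_cast Nat.succ_ne_zero q
  push_cast
  field_simp

end AlternatingForms

end SpincBochner

namespace SpincBochner

/-! ### Types `(1,0)` and `(0,1)` of a real vector, and their metric duals -/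

section Projections

variable {V : Type*} [NormedAddCommGroup V] [InnerProductSpace ℝ V]
  {J : V →ₗ[ℝ] V} (hJ : ∀ v, J (J v) = -v)

theorem coe_part10 (X : V) :
    (part10 J hJ X : ℂ ⊗[ℝ] V) = (1 / 2 : ℂ) • (1 ⊗ₜ X - Complex.I • 1 ⊗ₜ J X) := rfl

theorem coe_part01 (X : V) :
    (part01 J hJ X : ℂ ⊗[ℝ] V) = (1 / 2 : ℂ) • (1 ⊗ₜ X + Complex.I • 1 ⊗ₜ J X) := rfl

theorem one_tmul_real_smul (r : ℝ) (X : V) :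
    (1 : ℂ) ⊗ₜ[ℝ] (r • X) = (r : ℂ) • ((1 : ℂ) ⊗ₜ[ℝ] X) := by
  rw [TensorProduct.tmul_smul, TensorProduct.smul_tmul', TensorProduct.smul_tmul']
  simp

theorem part10_add (X Y : V) : part10 J hJ (X + Y) = part10 J hJ X + part10 J hJ Y := by
  rw [part10, TensorProduct.tmul_add, map_add]; rfl

theorem part01_add (X Y : V) : part01 J hJ (X + Y) = part01 J hJ X + part01 J hJ Y := by
  rw [part01, TensorProduct.tmul_add, map_add]; rfl

theorem part10_smul (r : ℝ) (X : V) : part10 J hJ (r • X) = (r : ℂ) • part10 J hJ X := by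
  rw [part10, one_tmul_real_smul, map_smul]; rfl

theorem part01_smul (r : ℝ) (X : V) : part01 J hJ (r • X) = (r : ℂ) • part01 J hJ X := by
  rw [part01, one_tmul_real_smul, map_smul]; rfl

theorem part10_J (X : V) : part10 J hJ (J X) = Complex.I • part10 J hJ X := by
  ext
  rw [Submodule.coe_smul, coe_part10, coe_part10, hJ, TensorProduct.tmul_neg, smul_comm,
    smul_sub Complex.I, smul_smul Complex.I, Complex.I_mul_I]
  module

theorem part01_J (X : V) : part01 J hJ (J X) = (-Complex.I) • part01 J hJ X := by
  ext
  rw [Submodule.coe_smul, coe_part01, coe_part01, hJ, TensorProduct.tmul_neg, smul_comm,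
    smul_add (-Complex.I), smul_smul (-Complex.I), neg_mul, Complex.I_mul_I]
  module

theorem dual10_add (X Y : V) : dual10 J hJ (X + Y) = dual10 J hJ X + dual10 J hJ Y := by
  ext; simp [dual10, part01_add]

theorem dual01_add (X Y : V) : dual01 J hJ (X + Y) = dual01 J hJ X + dual01 J hJ Y := by
  ext; simp [dual01, part10_add]

theorem dual10_smul (r : ℝ) (X : V) : dual10 J hJ (r • X) = (r : ℂ) • dual10 J hJ X := by
  ext; simp [dual10, part01_smul]

theorem dual01_smul (r : ℝ) (X : V) : dual01 J hJ (r • X) = (r : ℂ) • dual01 J hJ X := by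
  ext; simp [dual01, part10_smul]

theorem dual01_J (X : V) : dual01 J hJ (J X) = Complex.I • dual01 J hJ X := by
  ext; simp [dual01, part10_J]

variable (hs : ∀ u v, inner ℝ (J u) v = -inner ℝ u (J v))

theorem metricC_tmul (a b : ℂ) (u v : V) :
    metricC V (a ⊗ₜ u) (b ⊗ₜ v) = a * b * (inner ℝ u v : ℝ) := by
  simp [metricC, mul_comm, mul_assoc]

include hs in
theorem inner_J_J (hJ : ∀ v, J (J v) = -v) (u v : V) : inner ℝ (J u) (J v) = inner ℝ u v := by
  rw [hs, hJ, inner_neg_right, neg_neg]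

include hs in
theorem metricC_part10_part01 (X Y : V) :
    metricC V (part10 J hJ X : ℂ ⊗[ℝ] V) (part01 J hJ Y : ℂ ⊗[ℝ] V)
      = (1 / 2 : ℂ) * ((inner ℝ X Y : ℝ) + Complex.I * (inner ℝ X (J Y) : ℝ)) := by
  rw [coe_part10, coe_part01]
  simp only [map_smul, map_sub, map_add, LinearMap.smul_apply, LinearMap.sub_apply, metricC_tmul,
    inner_J_J hs hJ, hs X Y]
  simp only [smul_eq_mul, Complex.ofReal_neg]
  linear_combination (-1 / 4 * (inner ℝ X Y : ℂ)) * Complex.I_mul_I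

include hs in
theorem metricC_part01_part10 (X Y : V) :
    metricC V (part01 J hJ X : ℂ ⊗[ℝ] V) (part10 J hJ Y : ℂ ⊗[ℝ] V)
      = (1 / 2 : ℂ) * ((inner ℝ X Y : ℝ) - Complex.I * (inner ℝ X (J Y) : ℝ)) := by
  rw [coe_part10, coe_part01]
  simp only [map_smul, map_sub, map_add, LinearMap.smul_apply, LinearMap.add_apply, metricC_tmul,
    inner_J_J hs hJ, hs X Y]
  simp only [smul_eq_mul, Complex.ofReal_neg]
  linear_combination (-1 / 4 * (inner ℝ X Y : ℂ)) * Complex.I_mul_I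

include hs in
theorem inner_J_self (X : V) : inner ℝ X (J X) = 0 := by
  have := hs X X
  rw [real_inner_comm] at this
  linarith

include hs in
theorem dual01_part01_self (X : V) :
    dual01 J hJ X (part01 J hJ X) = ((‖X‖ ^ 2 / 2 : ℝ) : ℂ) := by
  refine (metricC_part10_part01 hJ hs X X).trans ?_
  rw [inner_J_self hs, real_inner_self_eq_norm_sq]
  push_cast
  ring

include hs in
theorem dual10_part10_self (X : V) :
    dual10 J hJ X (part10 J hJ X) = ((‖X‖ ^ 2 / 2 : ℝ) : ℂ) := by
  refine (metricC_part01_part10 hJ hs X X).trans ?_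
  rw [inner_J_self hs, real_inner_self_eq_norm_sq]
  push_cast
  ring

theorem sum_inner_smul_tmul {ι : Type*} [Fintype ι] (e : OrthonormalBasis ι ℝ V) (X : V) :
    ∑ b, (inner ℝ X (e b) : ℂ) • ((1 : ℂ) ⊗ₜ[ℝ] e b) = 1 ⊗ₜ X := by
  simp only [← one_tmul_real_smul, ← TensorProduct.tmul_sum, real_inner_comm (e _) X]
  rw [e.sum_repr' X]

include hs in
-- The expansion of `X` and of `J X` in `e` reduces the sum to half of `X₂ + √-1 (J X)₂`, and `(J
-- X)₂ = -√-1 X₂`. This is the hypothesis `hu` of `frameProd_contractForm`: the projected real frame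
-- serves as a unitary frame although it has twice as many vectors.
theorem sum_conj_dual01_smul_part01 {ι : Type*} [Fintype ι] (e : OrthonormalBasis ι ℝ V) (X : V) :
    ∑ b, starRingEnd ℂ (dual01 J hJ X (part01 J hJ (e b))) • part01 J hJ (e b)
      = part01 J hJ X := by
  have h (b : ι) : starRingEnd ℂ (dual01 J hJ X (part01 J hJ (e b)))
      = (1 / 2 : ℂ) * ((inner ℝ X (e b) : ℝ) + Complex.I * (inner ℝ (J X) (e b) : ℝ)) := by
    refine (congrArg _ (metricC_part10_part01 hJ hs X (e b))).trans ?_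
    rw [hs]
    simp [Complex.conj_ofNat]
  simp only [h]
  simp only [part01, ← map_smul, ← map_sum]
  simp only [mul_smul, add_smul, ← Finset.smul_sum, Finset.sum_add_distrib, sum_inner_smul_tmul]
  simp only [map_smul, map_add]
  change (1 / 2 : ℂ) • (part01 J hJ X + Complex.I • part01 J hJ (J X)) = part01 J hJ X
  rw [part01_J, smul_smul, mul_neg, Complex.I_mul_I]
  module

include hs in
theorem sum_conj_dual10_smul_part10 {ι : Type*} [Fintype ι] (e : OrthonormalBasis ι ℝ V) (X : V) :
    ∑ b, starRingEnd ℂ (dual10 J hJ X (part10 J hJ (e b))) • part10 J hJ (e b)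
      = part10 J hJ X := by
  have h (b : ι) : starRingEnd ℂ (dual10 J hJ X (part10 J hJ (e b)))
      = (1 / 2 : ℂ) * ((inner ℝ X (e b) : ℝ) - Complex.I * (inner ℝ (J X) (e b) : ℝ)) := by
    refine (congrArg _ (metricC_part01_part10 hJ hs X (e b))).trans ?_
    rw [hs]
    simp [Complex.conj_ofNat, sub_eq_add_neg]
  simp only [h]
  simp only [part10, ← map_smul, ← map_sum]
  simp only [mul_smul, sub_smul, ← Finset.smul_sum, Finset.sum_sub_distrib, sum_inner_smul_tmul]
  simp only [map_smul, map_sub]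
  change (1 / 2 : ℂ) • (part10 J hJ X - Complex.I • part10 J hJ (J X)) = part10 J hJ X
  rw [part10_J, smul_smul, Complex.I_mul_I]
  module

end Projections

/-! ### The Clifford action and the number operators -/

section CliffordAction

variable {V : Type*} [NormedAddCommGroup V] [InnerProductSpace ℝ V]
  {J : V →ₗ[ℝ] V} (hJ : ∀ v, J (J v) = -v)
  (W : Type*) [AddCommGroup W] [Module ℂ W]

theorem wedge0_apply_zero (X : V) (s : Forms0 J W) : wedge0 J hJ W X s 0 = 0 := rfl

theorem wedge0_apply_succ (X : V) (s : Forms0 J W) (q : ℕ) :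
    wedge0 J hJ W X s (q + 1) = wedgeForm (dual01 J hJ X) q (s q) := rfl

theorem contract0_apply (X : V) (s : Forms0 J W) (q : ℕ) :
    contract0 J hJ W X s q = contractForm (part01 J hJ X) q (s (q + 1)) := rfl

theorem wedgeForm_add {U N : Type*} [AddCommGroup U] [Module ℂ U] [AddCommGroup N] [Module ℂ N]
    (α β : Module.Dual ℂ U) (n : ℕ) :
    wedgeForm (N := N) (α + β) n = wedgeForm α n + wedgeForm β n := by
  ext; simp [wedgeForm_apply, add_smul, Finset.sum_add_distrib]

theorem wedgeForm_smul {U N : Type*} [AddCommGroup U] [Module ℂ U] [AddCommGroup N] [Module ℂ N]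
    (c : ℂ) (α : Module.Dual ℂ U) (n : ℕ) :
    wedgeForm (N := N) (c • α) n = c • wedgeForm α n := by
  ext; simp [wedgeForm_apply, mul_smul, Finset.smul_sum, smul_comm c]

theorem contractForm_add {U N : Type*} [AddCommGroup U] [Module ℂ U] [AddCommGroup N]
    [Module ℂ N] (u v : U) (n : ℕ) :
    contractForm (N := N) (u + v) n = contractForm u n + contractForm v n := by
  ext; simp [contractForm]

theorem contractForm_smul {U N : Type*} [AddCommGroup U] [Module ℂ U] [AddCommGroup N]
    [Module ℂ N] (c : ℂ) (u : U) (n : ℕ) :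
    contractForm (N := N) (c • u) n = c • contractForm u n := by
  ext; simp [contractForm]

theorem clifford0_add (X Y : V) :
    clifford0 J hJ W (X + Y) = clifford0 J hJ W X + clifford0 J hJ W Y := by
  have h1 : wedge0 J hJ W (X + Y) = wedge0 J hJ W X + wedge0 J hJ W Y := by
    ext s q : 2
    cases q with
    | zero => simp [wedge0_apply_zero]
    | succ q => simp [wedge0_apply_succ, dual01_add, wedgeForm_add]
  have h2 : contract0 J hJ W (X + Y) = contract0 J hJ W X + contract0 J hJ W Y := by
    ext s q : 2
    simp [contract0_apply, part01_add, contractForm_add]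
  rw [clifford0, clifford0, clifford0, h1, h2]
  module

theorem clifford0_smul (r : ℝ) (X : V) :
    clifford0 J hJ W (r • X) = (r : ℂ) • clifford0 J hJ W X := by
  have h1 : wedge0 J hJ W (r • X) = (r : ℂ) • wedge0 J hJ W X := by
    ext s q : 2
    cases q with
    | zero => simp [wedge0_apply_zero]
    | succ q => rw [wedge0_apply_succ, dual01_smul, wedgeForm_smul]; rfl
  have h2 : contract0 J hJ W (r • X) = (r : ℂ) • contract0 J hJ W X := by
    ext s q : 2
    simp [contract0_apply, part01_smul, contractForm_smul]
  rw [clifford0, clifford0, h1, h2]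
  module

/-- The number operator of the vector `X` on `Λ^{0,*} ⊗ W`: interior multiplication by `X₂`
followed by exterior multiplication by the metric dual of `X₁`. -/
noncomputable def number0 (J : V →ₗ[ℝ] V) (hJ : ∀ v, J (J v) = -v) (W : Type*) [AddCommGroup W]
    [Module ℂ W] (X : V) : Module.End ℂ (Forms0 J W) :=
  wedge0 J hJ W X * contract0 J hJ W X

theorem wedge0_mul_wedge0 (X : V) : wedge0 J hJ W X * wedge0 J hJ W X = 0 := by
  ext s q : 2
  match q with
  | 0 => rfl
  | 1 => simp [wedge0_apply_succ, wedge0_apply_zero]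
  | q + 2 => simp [wedge0_apply_succ, wedgeForm_wedgeForm]

theorem contract0_mul_contract0 (X : V) : contract0 J hJ W X * contract0 J hJ W X = 0 := by
  ext s q : 2
  simp [contract0_apply, contractForm_contractForm]

/-- The anticommutation relation in all degrees at once; degree `0` is separate because `number0`
vanishes there. The constant is the pairing of `X₂` with the dual of `X₁`. -/
theorem contract0_mul_wedge0_add (hs : ∀ u v, inner ℝ (J u) v = -inner ℝ u (J v)) (X : V) :
    contract0 J hJ W X * wedge0 J hJ W X + number0 J hJ W X
      = ((‖X‖ ^ 2 / 2 : ℝ) : ℂ) • 1 := by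
  rw [← dual01_part01_self hJ hs]
  ext s q : 2
  cases q with
  | zero =>
    simp [number0, contract0_apply, wedge0_apply_succ, wedge0_apply_zero,
      contractForm_wedgeForm_zero]
  | succ q =>
    simp [number0, contract0_apply, wedge0_apply_succ, contractForm_wedgeForm_add]

theorem clifford0_eq (X : V) : clifford0 J hJ W X
    = ((Real.sqrt 2 : ℝ) : ℂ) • (wedge0 J hJ W X - contract0 J hJ W X) := by
  rw [clifford0]
  module

theorem clifford0_J (X : V) : clifford0 J hJ W (J X)
    = (((Real.sqrt 2 : ℝ) : ℂ) * Complex.I) • (wedge0 J hJ W X + contract0 J hJ W X) := by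
  have h1 : wedge0 J hJ W (J X) = Complex.I • wedge0 J hJ W X := by
    ext s q : 2
    cases q with
    | zero => simp [wedge0_apply_zero]
    | succ q => simp [wedge0_apply_succ, dual01_J, wedgeForm_smul]
  have h2 : contract0 J hJ W (J X) = (-Complex.I) • contract0 J hJ W X := by
    ext s q : 2
    simp [contract0_apply, part01_J, contractForm_smul]
  rw [clifford0, h1, h2]
  module

theorem sqrt_two_mul_sqrt_two_complex :
    ((Real.sqrt 2 : ℝ) : ℂ) * ((Real.sqrt 2 : ℝ) : ℂ) = 2 := by
  rw [← Complex.ofReal_mul, Real.mul_self_sqrt (by norm_num)]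
  simp

theorem norm_sq_smul_one_eq (hs : ∀ u v, inner ℝ (J u) v = -inner ℝ u (J v)) (X : V) :
    ((‖X‖ ^ 2 : ℝ) : ℂ) • (1 : Module.End ℂ (Forms0 J W))
      = (2 : ℂ) • (contract0 J hJ W X * wedge0 J hJ W X + number0 J hJ W X) := by
  rw [contract0_mul_wedge0_add hJ W hs, smul_smul]
  congr 1
  push_cast
  ring

/-- Replacing `X` by `J X` multiplies the exterior part by `√-1` and the interior part by `-√-1`.
With `w` and `i` the two parts, the Clifford product is `2 √-1 (w + i)(w - i)`; the squares vanish,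
and `i w` is eliminated by anticommutation. -/
theorem I_smul_clifford0_J_mul_clifford0 (hs : ∀ u v, inner ℝ (J u) v = -inner ℝ u (J v))
    (X : V) :
    Complex.I • (clifford0 J hJ W (J X) * clifford0 J hJ W X)
      = (4 : ℂ) • number0 J hJ W X - ((‖X‖ ^ 2 : ℝ) : ℂ) • 1 := by
  rw [norm_sq_smul_one_eq hJ W hs, clifford0_J, clifford0_eq, smul_mul_smul_comm, smul_smul,
    add_mul, mul_sub, mul_sub, wedge0_mul_wedge0, contract0_mul_contract0, number0]
  rw [show Complex.I * (((Real.sqrt 2 : ℝ) : ℂ) * Complex.I * ((Real.sqrt 2 : ℝ) : ℂ)) = -2 by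
    linear_combination (Complex.I * Complex.I) * sqrt_two_mul_sqrt_two_complex
      + 2 * Complex.I_mul_I]
  module

theorem I_smul_clifford0_mul_clifford0_J (hs : ∀ u v, inner ℝ (J u) v = -inner ℝ u (J v))
    (X : V) :
    Complex.I • (clifford0 J hJ W X * clifford0 J hJ W (J X))
      = -((4 : ℂ) • number0 J hJ W X - ((‖X‖ ^ 2 : ℝ) : ℂ) • 1) := by
  rw [norm_sq_smul_one_eq hJ W hs, clifford0_J, clifford0_eq, smul_mul_smul_comm, smul_smul,
    sub_mul, mul_add, mul_add, wedge0_mul_wedge0, contract0_mul_contract0, number0]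
  rw [show Complex.I * (((Real.sqrt 2 : ℝ) : ℂ) * (((Real.sqrt 2 : ℝ) : ℂ) * Complex.I)) = -2 by
    linear_combination (Complex.I * Complex.I) * sqrt_two_mul_sqrt_two_complex
      + 2 * Complex.I_mul_I]
  module

/-- The action of an endomorphism of `Λ^{0,*} ⊗ W` on `Λ^{p,*} ⊗ W`, trivial on the factor
`Λ^{p,0}`. -/
noncomputable def liftForms (J : V →ₗ[ℝ] V) (W : Type*) [AddCommGroup W] [Module ℂ W] (p : ℕ) :
    Module.End ℂ (Forms0 J W) →ₗ[ℂ] Module.End ℂ (FormsP J p W) where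
  toFun T :=
    { toFun := fun s => T.compAlternatingMap s
      map_add' := fun s t => by ext; simp
      map_smul' := fun c s => by ext; simp }
  map_add' S T := by ext; simp
  map_smul' c T := by ext; simp

theorem liftForms_apply (p : ℕ) (T : Module.End ℂ (Forms0 J W)) (s : FormsP J p W)
    (v : Fin p → T10 J) : liftForms J W p T s v = T (s v) := rfl

theorem liftForms_mul (p : ℕ) (S T : Module.End ℂ (Forms0 J W)) :
    liftForms J W p (S * T) = liftForms J W p S * liftForms J W p T := rfl

theorem liftForms_one (p : ℕ) : liftForms J W p 1 = 1 := rfl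

theorem clifford_eq (p : ℕ) (X : V) : clifford J hJ W p X = liftForms J W p (clifford0 J hJ W X) :=
  rfl

theorem I_smul_clifford_J_mul_clifford (hs : ∀ u v, inner ℝ (J u) v = -inner ℝ u (J v))
    (p : ℕ) (X : V) :
    Complex.I • (clifford J hJ W p (J X) * clifford J hJ W p X)
      = (4 : ℂ) • liftForms J W p (number0 J hJ W X) - ((‖X‖ ^ 2 : ℝ) : ℂ) • 1 := by
  rw [clifford_eq, clifford_eq, ← liftForms_mul, ← map_smul,
    I_smul_clifford0_J_mul_clifford0 hJ W hs, map_sub, map_smul, map_smul, liftForms_one]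

theorem I_smul_clifford_mul_clifford_J (hs : ∀ u v, inner ℝ (J u) v = -inner ℝ u (J v))
    (p : ℕ) (X : V) :
    Complex.I • (clifford J hJ W p X * clifford J hJ W p (J X))
      = -((4 : ℂ) • liftForms J W p (number0 J hJ W X) - ((‖X‖ ^ 2 : ℝ) : ℂ) • 1) := by
  rw [clifford_eq, clifford_eq, ← liftForms_mul, ← map_smul,
    I_smul_clifford0_mul_clifford0_J hJ W hs, map_neg, map_sub, map_smul, map_smul, liftForms_one]

theorem clifford_add (p : ℕ) (X Y : V) :
    clifford J hJ W p (X + Y) = clifford J hJ W p X + clifford J hJ W p Y := by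
  simp [clifford_eq, clifford0_add]

theorem clifford_smul (p : ℕ) (r : ℝ) (X : V) :
    clifford J hJ W p (r • X) = (r : ℂ) • clifford J hJ W p X := by
  simp [clifford_eq, clifford0_smul]

theorem opA_add_left (p : ℕ) (X Y Z : V) :
    opA J hJ W p (X + Y) Z = opA J hJ W p X Z + opA J hJ W p Y Z := by
  cases p with
  | zero => simp [opA]
  | succ p => simp [opA, dual10_add, wedgeForm_add, LinearMap.add_comp]

theorem opA_add_right (p : ℕ) (X Y Z : V) :
    opA J hJ W p X (Y + Z) = opA J hJ W p X Y + opA J hJ W p X Z := by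
  cases p with
  | zero => simp [opA]
  | succ p => simp [opA, part10_add, contractForm_add, LinearMap.comp_add]

theorem opA_smul_left (p : ℕ) (r : ℝ) (X Y : V) :
    opA J hJ W p (r • X) Y = (r : ℂ) • opA J hJ W p X Y := by
  cases p with
  | zero => simp [opA]
  | succ p => simp only [opA]; rw [dual10_smul, wedgeForm_smul, LinearMap.smul_comp]

theorem opA_smul_right (p : ℕ) (r : ℝ) (X Y : V) :
    opA J hJ W p X (r • Y) = (r : ℂ) • opA J hJ W p X Y := by
  cases p with
  | zero => simp [opA]
  | succ p => simp [opA, part10_smul, contractForm_smul, LinearMap.comp_smul]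

theorem opA_J_right (p : ℕ) (X Y : V) :
    opA J hJ W p X (J Y) = Complex.I • opA J hJ W p X Y := by
  cases p with
  | zero => simp [opA]
  | succ p => simp [opA, part10_J, contractForm_smul, LinearMap.comp_smul]

end CliffordAction

end SpincBochner

namespace SpincBochner

/-! ### Adjointness and positivity for the induced Hermitian metric -/

section HermitianMetric

variable {V : Type*} [NormedAddCommGroup V] [InnerProductSpace ℝ V] [FiniteDimensional ℝ V]
  {J : V →ₗ[ℝ] V} (hJ : ∀ v, J (J v) = -v)
  {W : Type*} [NormedAddCommGroup W] [InnerProductSpace ℂ W]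

theorem herm0_eq_sum_frameProd (s t : Forms0 J W) :
    herm0 J hJ s t = ∑ q ∈ Finset.range (Module.finrank ℝ V + 1),
      frameProd (innerₛₗ ℂ · ·) (fun b => part01 J hJ (stdOrthonormalBasis ℝ V b)) q (s q) (t q) :=
  rfl

theorem herm0_conj (s t : Forms0 J W) : starRingEnd ℂ (herm0 J hJ s t) = herm0 J hJ t s := by
  rw [herm0_eq_sum_frameProd, herm0_eq_sum_frameProd, map_sum]
  exact Finset.sum_congr rfl fun q _ => frameProd_conj (fun x y => inner_conj_symm y x) _ _ _ _

/-- The Hermitian metric of `Λ^{0,*} ⊗ W` as a sesquilinear form. -/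
noncomputable def herm0ₛₗ (J : V →ₗ[ℝ] V) (hJ : ∀ v, J (J v) = -v) (W : Type*)
    [NormedAddCommGroup W] [InnerProductSpace ℂ W] :
    Forms0 J W →ₗ⋆[ℂ] Forms0 J W →ₗ[ℂ] ℂ :=
  LinearMap.mk₂'ₛₗ (starRingEnd ℂ) (RingHom.id ℂ) (herm0 J hJ)
    (fun s s' t => by
      simp only [herm0, Pi.add_apply, AlternatingMap.add_apply, inner_add_left,
        Finset.sum_add_distrib, mul_add])
    (fun c s t => by
      simp only [herm0, Pi.smul_apply, AlternatingMap.smul_apply, inner_smul_left,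
        ← Finset.mul_sum, smul_eq_mul, mul_left_comm _ (starRingEnd ℂ c)])
    (fun s t t' => by
      simp only [herm0, Pi.add_apply, AlternatingMap.add_apply, inner_add_right,
        Finset.sum_add_distrib, mul_add])
    (fun c s t => by
      simp only [herm0, Pi.smul_apply, AlternatingMap.smul_apply, inner_smul_right,
        ← Finset.mul_sum, smul_eq_mul, mul_left_comm _ c, RingHom.id_apply])

theorem herm0_self_nonneg (s : Forms0 J W) : 0 ≤ (herm0 J hJ s s).re := by
  simp only [herm0, Complex.re_sum]
  refine Finset.sum_nonneg fun q _ => ?_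
  rw [← Complex.ofReal_natCast, ← Complex.ofReal_inv, Complex.re_ofReal_mul, Complex.re_sum]
  exact mul_nonneg (by positivity) (Finset.sum_nonneg fun b _ => inner_self_nonneg (𝕜 := ℂ))

theorem herm0_wedge0 (hs : ∀ u v, inner ℝ (J u) v = -inner ℝ u (J v)) (X : V)
    (s t : Forms0 J W) :
    herm0 J hJ (wedge0 J hJ W X s) t = herm0 J hJ s (contract0 J hJ W X t) := by
  have h (q : ℕ) := frameProd_contractForm (innerₛₗ ℂ (E := W))
    (fun b => part01 J hJ (stdOrthonormalBasis ℝ V b)) (dual01 J hJ X) (part01 J hJ X)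
    (sum_conj_dual01_smul_part01 hJ hs _ X) q (s q) (t (q + 1))
  rw [herm0_eq_sum_frameProd, herm0_eq_sum_frameProd, Finset.sum_range_succ',
    Finset.sum_range_succ, wedge0_apply_zero]
  congr 1
  · exact Finset.sum_congr rfl fun q _ => h q
  -- The shift of degree leaves over the top degree `dim V` on the right. It pairs with forms of
  -- degree `dim V + 1`, which vanish on frame tuples because some frame vector is repeated.
  · refine Eq.trans ?_ (h _)
    have hinj (b : Fin (Module.finrank ℝ V + 1) → Fin (Module.finrank ℝ V)) :
        t (Module.finrank ℝ V + 1) (fun i => part01 J hJ (stdOrthonormalBasis ℝ V (b i))) = 0 := by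
      obtain ⟨i, j, hij, hb⟩ := Fintype.exists_ne_map_eq_of_card_lt b (by simp)
      exact (t _).map_eq_zero_of_eq _ (by rw [hb]) hij
    simp [frameProd, hinj]

theorem herm_eq_frameProd (p : ℕ) (s t : FormsP J p W) :
    herm J hJ p s t = frameProd (herm0ₛₗ J hJ W · ·)
      (fun b => part10 J hJ (stdOrthonormalBasis ℝ V b)) p s t := rfl

theorem herm_conj (p : ℕ) (s t : FormsP J p W) :
    starRingEnd ℂ (herm J hJ p s t) = herm J hJ p t s := by
  have h (x y : Forms0 J W) : starRingEnd ℂ (herm0ₛₗ J hJ W x y) = herm0ₛₗ J hJ W y x :=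
    herm0_conj hJ x y
  rw [herm_eq_frameProd, herm_eq_frameProd, frameProd_conj h]

theorem herm_self_nonneg (p : ℕ) (s : FormsP J p W) : 0 ≤ (herm J hJ p s s).re := by
  rw [herm, ← Complex.ofReal_natCast, ← Complex.ofReal_inv, Complex.re_ofReal_mul, Complex.re_sum]
  exact mul_nonneg (by positivity) (Finset.sum_nonneg fun b _ => herm0_self_nonneg hJ _)

theorem herm_add_left (p : ℕ) (s s' t : FormsP J p W) :
    herm J hJ p (s + s') t = herm J hJ p s t + herm J hJ p s' t := by
  simp only [herm_eq_frameProd, frameProd, AlternatingMap.add_apply, map_add, LinearMap.add_apply,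
    Finset.sum_add_distrib, mul_add]

theorem herm_smul_left (p : ℕ) (c : ℂ) (s t : FormsP J p W) :
    herm J hJ p (c • s) t = starRingEnd ℂ c * herm J hJ p s t := by
  simp only [herm_eq_frameProd, frameProd, AlternatingMap.smul_apply, map_smulₛₗ,
    LinearMap.smul_apply, smul_eq_mul, ← Finset.mul_sum]
  ring

theorem herm_add_right (p : ℕ) (s t t' : FormsP J p W) :
    herm J hJ p s (t + t') = herm J hJ p s t + herm J hJ p s t' := by
  rw [← herm_conj, herm_add_left, map_add, herm_conj, herm_conj]

theorem herm_smul_right (p : ℕ) (c : ℂ) (s t : FormsP J p W) :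
    herm J hJ p s (c • t) = c * herm J hJ p s t := by
  rw [← herm_conj, herm_smul_left, map_mul, herm_conj, Complex.conj_conj]

theorem herm_wedgeForm (hs : ∀ u v, inner ℝ (J u) v = -inner ℝ u (J v)) (X : V) (p : ℕ)
    (s : FormsP J p W) (t : FormsP J (p + 1) W) :
    herm J hJ (p + 1) (wedgeForm (dual10 J hJ X) p s) t
      = herm J hJ p s (contractForm (part10 J hJ X) p t) :=
  frameProd_contractForm (herm0ₛₗ J hJ W) _ _ _ (sum_conj_dual10_smul_part10 hJ hs _ X) p s t

namespace BoundedBelow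

variable {hJ} {p : ℕ} {S T : Module.End ℂ (FormsP J p W)} {a b : ℝ}

theorem add (hS : BoundedBelow J hJ p S a) (hT : BoundedBelow J hJ p T b) :
    BoundedBelow J hJ p (S + T) (a + b) := by
  refine ⟨fun s t => ?_, fun s => ?_⟩
  · rw [LinearMap.add_apply, LinearMap.add_apply, herm_add_left, herm_add_right, hS.1, hT.1]
  · rw [LinearMap.add_apply, herm_add_left, Complex.add_re, add_mul]
    exact add_le_add (hS.2 s) (hT.2 s)

theorem smul (hS : BoundedBelow J hJ p S a) {r : ℝ} (hr : 0 ≤ r) :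
    BoundedBelow J hJ p ((r : ℂ) • S) (r * a) := by
  refine ⟨fun s t => ?_, fun s => ?_⟩
  · rw [LinearMap.smul_apply, LinearMap.smul_apply, herm_smul_left, herm_smul_right, hS.1,
      Complex.conj_ofReal]
  · rw [LinearMap.smul_apply, herm_smul_left, Complex.conj_ofReal, Complex.re_ofReal_mul, mul_assoc]
    exact mul_le_mul_of_nonneg_left (hS.2 s) hr

theorem mono (hS : BoundedBelow J hJ p S a) (hab : b ≤ a) : BoundedBelow J hJ p S b :=
  ⟨hS.1, fun s => (mul_le_mul_of_nonneg_right hab (herm_self_nonneg hJ p s)).trans (hS.2 s)⟩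

theorem const (hJ : ∀ v, J (J v) = -v) (p : ℕ) (c : ℝ) :
    BoundedBelow (W := W) J hJ p ((c : ℂ) • 1) c := by
  refine ⟨fun s t => ?_, fun s => ?_⟩
  · rw [LinearMap.smul_apply, LinearMap.smul_apply, herm_smul_left, herm_smul_right,
      Complex.conj_ofReal]
    rfl
  · rw [LinearMap.smul_apply, herm_smul_left, Complex.conj_ofReal, Complex.re_ofReal_mul]
    rfl

theorem sum {ι : Type*} {F : Finset ι} {T : ι → Module.End ℂ (FormsP J p W)} {a : ι → ℝ}
    (h : ∀ i ∈ F, BoundedBelow J hJ p (T i) (a i)) :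
    BoundedBelow J hJ p (∑ i ∈ F, T i) (∑ i ∈ F, a i) := by
  classical
  induction F using Finset.induction_on with
  | empty => simpa using const (W := W) hJ p 0
  | insert i F hi ih =>
    rw [Finset.sum_insert hi, Finset.sum_insert hi]
    exact (h i (Finset.mem_insert_self i F)).add
      (ih fun j hj => h j (Finset.mem_insert_of_mem hj))

/-- Exterior multiplication by the dual of `X₂` is adjoint to interior multiplication by `X₁`, so
`A(X, X)` has the form `T* T` with `T` the interior multiplication. -/
theorem opA_self (hJ : ∀ v, J (J v) = -v) (hs : ∀ u v, inner ℝ (J u) v = -inner ℝ u (J v))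
    (p : ℕ) (X : V) : BoundedBelow (W := W) J hJ p (opA J hJ W p X X) 0 := by
  cases p with
  | zero => simpa [opA] using const (W := W) hJ 0 0
  | succ p =>
    have h (s t : FormsP J (p + 1) W) : herm J hJ (p + 1) (opA J hJ W (p + 1) X X s) t
        = herm J hJ p (contractForm (part10 J hJ X) p s) (contractForm (part10 J hJ X) p t) :=
      herm_wedgeForm hJ hs X p _ _
    refine ⟨fun s t => ?_, fun s => ?_⟩
    · rw [h, ← herm_conj hJ _ (opA J hJ W (p + 1) X X t) s, h, herm_conj]
    · rw [h, zero_mul]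
      exact herm_self_nonneg hJ p _

/-- By anticommutation the difference is interior after exterior multiplication, again of the form
`T* T`. With `opA_self` this encloses `A(X, X)` between `0` and `|X|²/2`. -/
theorem sub_opA_self (hJ : ∀ v, J (J v) = -v) (hs : ∀ u v, inner ℝ (J u) v = -inner ℝ u (J v))
    (p : ℕ) (X : V) :
    BoundedBelow (W := W) J hJ p (((‖X‖ ^ 2 / 2 : ℝ) : ℂ) • 1 - opA J hJ W p X X) 0 := by
  have h1 (s : FormsP J p W) : (((‖X‖ ^ 2 / 2 : ℝ) : ℂ) • 1 - opA J hJ W p X X) s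
      = contractForm (part10 J hJ X) p (wedgeForm (dual10 J hJ X) p s) := by
    rw [← dual10_part10_self hJ hs]
    cases p with
    | zero => simp [opA, contractForm_wedgeForm_zero]
    | succ p => simp [opA, sub_eq_iff_eq_add, contractForm_wedgeForm_add]
  have h (s t : FormsP J p W) :
      herm J hJ p s ((((‖X‖ ^ 2 / 2 : ℝ) : ℂ) • 1 - opA J hJ W p X X) t)
        = herm J hJ (p + 1) (wedgeForm (dual10 J hJ X) p s) (wedgeForm (dual10 J hJ X) p t) := by
    rw [h1, herm_wedgeForm hJ hs]
  refine ⟨fun s t => ?_, fun s => ?_⟩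
  · rw [h, ← herm_conj, h, herm_conj]
  · rw [zero_mul, ← Complex.conj_re, herm_conj, h]
    exact herm_self_nonneg hJ _ _

theorem liftForms_of_herm0 {R : Module.End ℂ (Forms0 J W)}
    (hR : ∀ s t, herm0 J hJ (R s) t = herm0 J hJ s (R t))
    (hR' : ∀ s, 0 ≤ (herm0 J hJ (R s) s).re) :
    BoundedBelow J hJ p (liftForms J W p R) 0 := by
  refine ⟨fun s t => ?_, fun s => ?_⟩
  · simp only [herm, liftForms_apply, hR]
  · rw [zero_mul, herm, ← Complex.ofReal_natCast, ← Complex.ofReal_inv, Complex.re_ofReal_mul,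
      Complex.re_sum]
    exact mul_nonneg (by positivity) (Finset.sum_nonneg fun b _ => hR' _)

theorem number0 (hJ : ∀ v, J (J v) = -v) (hs : ∀ u v, inner ℝ (J u) v = -inner ℝ u (J v))
    (p : ℕ) (X : V) : BoundedBelow (W := W) J hJ p (liftForms J W p (number0 J hJ W X)) 0 := by
  have h (s t : Forms0 J W) : herm0 J hJ (SpincBochner.number0 J hJ W X s) t
      = herm0 J hJ (contract0 J hJ W X s) (contract0 J hJ W X t) := herm0_wedge0 hJ hs X _ _
  refine liftForms_of_herm0 (fun s t => ?_) fun s => ?_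
  · rw [h, ← herm0_conj hJ (SpincBochner.number0 J hJ W X t) s, h, herm0_conj]
  · rw [h]
    exact herm0_self_nonneg hJ _

/-- The same complement for `N(X)`: the difference is interior after exterior multiplication on the
antiholomorphic factor. -/
theorem sub_number0 (hJ : ∀ v, J (J v) = -v) (hs : ∀ u v, inner ℝ (J u) v = -inner ℝ u (J v))
    (p : ℕ) (X : V) :
    BoundedBelow (W := W) J hJ p
      (((‖X‖ ^ 2 / 2 : ℝ) : ℂ) • 1 - liftForms J W p (SpincBochner.number0 J hJ W X)) 0 := by
  have e : ((‖X‖ ^ 2 / 2 : ℝ) : ℂ) • 1 - liftForms J W p (SpincBochner.number0 J hJ W X)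
      = liftForms J W p (contract0 J hJ W X * wedge0 J hJ W X) := by
    rw [eq_sub_of_add_eq (contract0_mul_wedge0_add hJ W hs X), map_sub, map_smul, liftForms_one]
  rw [e]
  have h (s t : Forms0 J W) : herm0 J hJ s ((contract0 J hJ W X * wedge0 J hJ W X) t)
      = herm0 J hJ (wedge0 J hJ W X s) (wedge0 J hJ W X t) := (herm0_wedge0 hJ hs X _ _).symm
  refine liftForms_of_herm0 (fun s t => ?_) fun s => ?_
  · rw [h, ← herm0_conj, h, herm0_conj]
  · rw [← Complex.conj_re, herm0_conj, h]
    exact herm0_self_nonneg hJ _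

end BoundedBelow

end HermitianMetric

end SpincBochner

namespace SpincBochner

/-! ### Traces of real bilinear maps -/

section OrthonormalSums

variable {V : Type*} [NormedAddCommGroup V] [InnerProductSpace ℝ V]
  {F : Type*} [AddCommGroup F] [Module ℂ F]

/-- A map of two real vectors into a complex vector space that is linear over the reals in each
of them. -/
structure IsRealBilinear (B : V → V → F) : Prop where
  add_left : ∀ x y z, B (x + y) z = B x z + B y z
  add_right : ∀ x y z, B x (y + z) = B x y + B x z
  smul_left : ∀ (r : ℝ) x y, B (r • x) y = (r : ℂ) • B x y
  smul_right : ∀ (r : ℝ) x y, B x (r • y) = (r : ℂ) • B x y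

namespace IsRealBilinear

variable {B : V → V → F} (hB : IsRealBilinear B)
include hB

theorem sum_left {ι : Type*} (s : Finset ι) (r : ι → ℝ) (x : ι → V) (y : V) :
    B (∑ i ∈ s, r i • x i) y = ∑ i ∈ s, (r i : ℂ) • B (x i) y := by
  classical
  induction s using Finset.induction_on with
  | empty => simpa using hB.smul_left 0 0 y
  | insert i s hi ih => rw [Finset.sum_insert hi, Finset.sum_insert hi, hB.add_left, ih,
      hB.smul_left]

theorem sum_right {ι : Type*} (s : Finset ι) (r : ι → ℝ) (x : V) (y : ι → V) :
    B x (∑ i ∈ s, r i • y i) = ∑ i ∈ s, (r i : ℂ) • B x (y i) := by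
  classical
  induction s using Finset.induction_on with
  | empty => simpa using hB.smul_right 0 x 0
  | insert i s hi ih => rw [Finset.sum_insert hi, Finset.sum_insert hi, hB.add_right, ih,
      hB.smul_right]

/-- The trace of a bilinear map does not depend on the orthonormal basis. -/
theorem sum_apply_orthonormalBasis {ι κ : Type*} [Fintype ι] [Fintype κ]
    (e : OrthonormalBasis ι ℝ V) (f : OrthonormalBasis κ ℝ V) (T : V →ₗ[ℝ] V) :
    ∑ j, B (e j) (T (e j)) = ∑ l, B (f l) (T (f l)) := by
  calc ∑ j, B (e j) (T (e j))
      = ∑ j, ∑ l, (inner ℝ (f l) (e j) : ℂ) • B (f l) (T (e j)) := by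
        refine Finset.sum_congr rfl fun j _ => ?_
        rw [← hB.sum_left Finset.univ, f.sum_repr']
    _ = ∑ l, B (f l) (∑ j, (inner ℝ (e j) (f l) : ℝ) • T (e j)) := by
        rw [Finset.sum_comm]
        refine Finset.sum_congr rfl fun l _ => ?_
        rw [hB.sum_right]
        simp only [real_inner_comm (f l)]
    _ = _ := by
        refine Finset.sum_congr rfl fun l _ => ?_
        simp only [← map_smul, ← map_sum]
        rw [e.sum_repr']

end IsRealBilinear

end OrthonormalSums

/-! ### Linear algebra of the Hessian at a critical point -/

section Linearization

variable {V : Type*} [NormedAddCommGroup V] [InnerProductSpace ℝ V]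

/-- The shape of the derivative `D` of the Hamiltonian vector field of the norm square of a moment
map at a critical point: `v i` are the values of the generating vector fields, `L` is the derivative
of the generating vector field that vanishes at the point, and `a j` are half the eigenvalues of the
Hessian. -/
structure IsMomentLinearization {ι κ : Type*} [Fintype ι] [Fintype κ] (J D L : V →ₗ[ℝ] V)
    (v : κ → V) (e : OrthonormalBasis ι ℝ V) (a : ι → ℝ) : Prop where
  sq : ∀ x, J (J x) = -x
  skew : ∀ x y, inner ℝ (J x) y = -inner ℝ x (J y)
  decomp : ∀ x, D x = ∑ i, (2 * inner ℝ (J (v i)) x) • v i + (2 : ℝ) • L x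
  comm : ∀ x, L (J x) = J (L x)
  symm : (J ∘ₗ L).IsSymmetric
  orthogonal : ∀ x i, inner ℝ (J (L x)) (v i) = 0
  hessian : ∀ j, J (D (e j)) = (2 * a j) • e j

namespace IsMomentLinearization

variable {ι κ : Type*} [Fintype ι] [Fintype κ] {J D L : V →ₗ[ℝ] V}
  {v : κ → V} {e : OrthonormalBasis ι ℝ V} {a : ι → ℝ} (h : IsMomentLinearization J D L v e a)
  {lam : Type*} [Fintype lam] (f : OrthonormalBasis lam ℝ V) (σ : lam → ℝ)
  (hf : ∀ l, J (L (f l)) = σ l • f l)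
include h

theorem norm_J (x : V) : ‖J x‖ = ‖x‖ := by
  rw [norm_eq_sqrt_real_inner, norm_eq_sqrt_real_inner, inner_J_J h.skew h.sq]

include hf

/-- In the basis `f` the eigenvalue equation reads `L (f l) = -σ l • J (f l)`, and the rank one
terms of `D` reassemble into the expansion of `J (v i)`. The map `B` is left general since the
formula serves for the Clifford products, for `A`, for the real traces of `D` and `J D`, and for the
signed trace in `sum_abs_le`. -/
theorem sum_apply {F : Type*} [AddCommGroup F] [Module ℂ F] {B : V → V → F}
    (hB : IsRealBilinear B) :
    ∑ j, B (e j) (D (e j))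
      = (2 : ℂ) • ∑ i, B (J (v i)) (v i) - (2 : ℂ) • ∑ l, (σ l : ℂ) • B (f l) (J (f l)) := by
  rw [hB.sum_apply_orthonormalBasis e f D]
  have hL (l : lam) : L (f l) = (-σ l) • J (f l) := by
    have := congrArg J (hf l)
    rw [h.sq, map_smul] at this
    rw [neg_smul, ← this, neg_neg]
  simp only [h.decomp, hB.add_right, hB.sum_right, hB.smul_right, hL, Finset.sum_add_distrib]
  rw [Finset.sum_comm, sub_eq_add_neg, Finset.smul_sum, Finset.smul_sum, ← Finset.sum_neg_distrib]
  congr 1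
  · refine Finset.sum_congr rfl fun i _ => ?_
    conv_rhs => rw [← f.sum_repr' (J (v i)), hB.sum_left, Finset.smul_sum]
    refine Finset.sum_congr rfl fun l _ => ?_
    rw [smul_smul, real_inner_comm]
    push_cast
    rfl
  · refine Finset.sum_congr rfl fun l _ => ?_
    push_cast
    module

/-- Duality for the trace norm: let `ε` be the sign of `S = J L`, with value `1` on the kernel. In
the eigenbasis `e` of `J D = 2 (P + S)` the trace of `ε J D` is at most `2 ∑ |a j|`. In the basis
`f` the same trace is `2 ∑ ‖v i‖² + 2 ∑ |σ l|`, because the vectors `J (v i)` that span the range of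
`P` lie in the kernel of `S`. -/
theorem sum_abs_le : ∑ l, |σ l| + ∑ i, ‖v i‖ ^ 2 ≤ ∑ j, |a j| := by
  -- The value at `σ l = 0` has to be `1`, so that `ε` is the identity on the vectors `J (v i)`.
  set ε : lam → ℝ := fun l => if σ l < 0 then -1 else 1 with hε
  have hεσ (l : lam) : σ l * ε l = |σ l| := by
    simp only [hε]
    split_ifs with hl
    · rw [abs_of_neg hl]; ring
    · rw [abs_of_nonneg (not_lt.1 hl)]; ring
  have hB : IsRealBilinear (fun x y : V =>
      ((∑ l, ε l * inner ℝ (f l) x * inner ℝ (f l) (J y) : ℝ) : ℂ)) := by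
    constructor
    · intro x y z
      rw [← Complex.ofReal_add, ← Finset.sum_add_distrib]
      simp only [inner_add_right, mul_add, add_mul]
    · intro x y z
      rw [← Complex.ofReal_add, ← Finset.sum_add_distrib]
      simp only [map_add, inner_add_right, mul_add]
    · intro r x y
      rw [smul_eq_mul, ← Complex.ofReal_mul, Finset.mul_sum]
      simp only [inner_smul_right, mul_assoc, mul_left_comm r]
    · intro r x y
      rw [smul_eq_mul, ← Complex.ofReal_mul, Finset.mul_sum]
      simp only [map_smul, inner_smul_right, mul_assoc, mul_left_comm r]
  have key := h.sum_apply f σ hf hB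
  have h1 (j : ι) : ∑ l, ε l * inner ℝ (f l) (e j) * inner ℝ (f l) (J (D (e j))) ≤ 2 * |a j| := by
    simp only [h.hessian, inner_smul_right]
    have hle : |∑ l, ε l * inner ℝ (f l) (e j) ^ 2| ≤ 1 := by
      refine (Finset.abs_sum_le_sum_abs _ _).trans ?_
      have : ∑ l, inner ℝ (f l) (e j) ^ 2 = 1 := by
        rw [f.sum_sq_inner_right, e.norm_eq_one, one_pow]
      rw [← this]
      refine Finset.sum_le_sum fun l _ => ?_
      rw [abs_mul, abs_of_nonneg (sq_nonneg (inner ℝ (f l) (e j)))]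
      refine mul_le_of_le_one_left (sq_nonneg _) ?_
      simp only [hε]
      split_ifs <;> simp
    calc ∑ l, ε l * inner ℝ (f l) (e j) * (2 * a j * inner ℝ (f l) (e j))
        = 2 * (a j * ∑ l, ε l * inner ℝ (f l) (e j) ^ 2) := by
          rw [Finset.mul_sum, Finset.mul_sum]
          exact Finset.sum_congr rfl fun l _ => by ring
      _ ≤ 2 * |a j| := by
          refine mul_le_mul_of_nonneg_left ((le_abs_self _).trans ?_) zero_le_two
          rw [abs_mul]
          exact mul_le_of_le_one_right (abs_nonneg _) hle
  -- By symmetry, an image orthogonal to `v i` means that `v i` is in the kernel; since `L` commutes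
  -- with `J`, so is `J (v i)`.
  have hSv (i : κ) : J (L (v i)) = 0 := by
    refine ext_inner_left ℝ fun w => ?_
    rw [inner_zero_right]
    exact (h.symm w (v i)).symm.trans (h.orthogonal w i)
  have h2 (i : κ) : ∑ l, ε l * inner ℝ (f l) (J (v i)) * inner ℝ (f l) (J (v i)) = ‖v i‖ ^ 2 := by
    rw [← h.norm_J (v i), ← f.sum_sq_inner_right]
    refine Finset.sum_congr rfl fun l _ => ?_
    -- Hence `J (v i)` has no component along the `f l` with `σ l ≠ 0`.
    have h0 : σ l * inner ℝ (f l) (J (v i)) = 0 := by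
      have : inner ℝ (J (L (f l))) (J (v i)) = 0 := by
        refine (h.symm (f l) (J (v i))).trans ?_
        rw [LinearMap.comp_apply, h.comm, hSv, map_zero, inner_zero_right]
      rwa [hf, real_inner_smul_left] at this
    rcases mul_eq_zero.1 h0 with h0 | h0
    · simp only [hε, h0, lt_self_iff_false, if_false]
      ring
    · simp [h0]
  have h3 (l : lam) : ∑ l', ε l' * inner ℝ (f l') (f l) * inner ℝ (f l') (J (J (f l))) = -ε l := by
    classical
    simp [h.sq, f.inner_eq_ite]
  simp only [h2, h3] at key
  have key' : ∑ j, ∑ l, ε l * inner ℝ (f l) (e j) * inner ℝ (f l) (J (D (e j)))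
      = 2 * ∑ i, ‖v i‖ ^ 2 + 2 * ∑ l, |σ l| := by
    simp only [smul_eq_mul, ← Complex.ofReal_sum, ← Complex.ofReal_mul] at key
    simp only [mul_neg, hεσ, Finset.sum_neg_distrib] at key
    rw [← sub_eq_zero, ← Complex.ofReal_eq_zero]
    push_cast at key ⊢
    rw [key]
    ring
  have := Finset.sum_le_sum fun j (_ : j ∈ Finset.univ) => h1 j
  rw [key', ← Finset.mul_sum] at this
  linarith

theorem trace_D : LinearMap.trace ℝ V D = 0 := by
  have hB : IsRealBilinear (fun x y : V => ((inner ℝ x y : ℝ) : ℂ)) :=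
    ⟨by simp [inner_add_left], by simp [inner_add_right], by simp [real_inner_smul_left],
      by simp [inner_smul_right]⟩
  have key := h.sum_apply f σ hf hB
  have : ∀ x, inner ℝ (J x) x = 0 := fun x => by rw [h.skew, inner_J_self h.skew, neg_zero]
  simp only [this, inner_J_self h.skew] at key
  rw [LinearMap.trace_eq_sum_inner D e, ← Complex.ofReal_eq_zero]
  push_cast
  rw [key]
  simp

theorem trace_J_comp_D :
    LinearMap.trace ℝ V (J ∘ₗ D) = 2 * ∑ i, ‖v i‖ ^ 2 + 2 * ∑ l, σ l := by
  have hB : IsRealBilinear (fun x y : V => ((inner ℝ x (J y) : ℝ) : ℂ)) :=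
    ⟨by simp [inner_add_left], by simp [inner_add_right], by simp [real_inner_smul_left],
      by simp [inner_smul_right]⟩
  have key := h.sum_apply f σ hf hB
  simp only [h.sq, inner_J_J h.skew h.sq, inner_neg_right, real_inner_self_eq_norm_sq,
    f.norm_eq_one]
    at key
  rw [LinearMap.trace_eq_sum_inner _ e, ← sub_eq_zero, ← Complex.ofReal_eq_zero]
  push_cast at key ⊢
  simp only [Function.comp_apply]
  rw [key]
  simp

end IsMomentLinearization

/-- The endomorphism `(D - √-1 J D) / 2` of `V ⊗ ℂ` already takes values in `T^{(1,0)}`, so the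
projection fixes its image, and by cyclicity the trace over `T^{(1,0)}` is the trace over all of `V
⊗ ℂ`. -/
theorem trace10_comp [FiniteDimensional ℝ V] {J : V →ₗ[ℝ] V} (hJ : ∀ v, J (J v) = -v)
    (D : V →ₗ[ℝ] V) :
    trace10 J hJ D (J ∘ₗ D)
      = (1 / 2 : ℂ) * (LinearMap.trace ℝ V D - Complex.I * LinearMap.trace ℝ V (J ∘ₗ D)) := by
  have hcomp : (T10 J).subtype ∘ₗ proj10 J hJ ∘ₗ
        ((1 / 2 : ℂ) • (D.baseChange ℂ - Complex.I • (J ∘ₗ D).baseChange ℂ))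
      = (1 / 2 : ℂ) • (D.baseChange ℂ - Complex.I • (J ∘ₗ D).baseChange ℂ) := by
    ext z
    change (1 / 2 : ℂ) • ((1 / 2 : ℂ) • ((1 : ℂ) ⊗ₜ[ℝ] D z - Complex.I • (1 : ℂ) ⊗ₜ[ℝ] J (D z))
      - Complex.I • J.baseChange ℂ
        ((1 / 2 : ℂ) • ((1 : ℂ) ⊗ₜ[ℝ] D z - Complex.I • (1 : ℂ) ⊗ₜ[ℝ] J (D z))))
      = (1 / 2 : ℂ) • ((1 : ℂ) ⊗ₜ[ℝ] D z - Complex.I • (1 : ℂ) ⊗ₜ[ℝ] J (D z))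
    simp only [map_smul, map_sub, LinearMap.baseChange_tmul, hJ, TensorProduct.tmul_neg]
    simp only [smul_sub, smul_neg, smul_smul]
    rw [show Complex.I * (1 / 2 * Complex.I) = -(1 / 2) by
      linear_combination (1 / 2 : ℂ) * Complex.I_mul_I]
    module
  rw [trace10, ← LinearMap.comp_assoc, LinearMap.trace_comp_comm', hcomp, map_smul, map_sub,
    map_smul, LinearMap.trace_baseChange, LinearMap.trace_baseChange]
  simp

end Linearization

/-! ### The endomorphism in terms of number operators -/

section Algebra

/-- The terms in `A i` cancel, as do the two halves of `w i • u`, and the two halves of `√-1 C i`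
add up to `4 N i - w i`. For each `l`, the Clifford term gives `σ l (2 N' l - u / 2)` and the trace
gives the other `-σ l u / 2`. -/
theorem bochner_sum_eq {ι κ E : Type*} [Fintype ι] [Fintype κ] [AddCommGroup E] [Module ℂ E]
    (w : κ → ℂ) (σ : ι → ℂ) (u : E) (C N A : κ → E) (C' N' A' A'' : ι → E)
    (hC : ∀ i, Complex.I • C i = (4 : ℂ) • N i - w i • u)
    (hC' : ∀ l, Complex.I • C' l = -((4 : ℂ) • N' l - u))
    (hA' : ∀ l, A' l = Complex.I • A'' l) :
    (Complex.I / 4) • ((2 : ℂ) • ∑ i, C i - (2 : ℂ) • ∑ l, σ l • C' l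
          + (4 : ℂ) • ((2 : ℂ) • ∑ i, A i - (2 : ℂ) • ∑ l, σ l • A' l))
        - ((1 / 2 : ℂ) * (∑ i, w i + ∑ l, σ l)) • u
        + (1 / 2 : ℂ) • ∑ i, (Complex.I • C i + w i • u - (4 * Complex.I) • A i)
      = ∑ i, ((4 : ℂ) • N i - w i • u)
        + ∑ l, σ l • ((2 : ℂ) • N' l + (2 : ℂ) • A'' l - u) := by
  have e1 (l : ι) : σ l • ((2 : ℂ) • N' l + (2 : ℂ) • A'' l - u)
      = -((Complex.I / 2) • (σ l • C' l)) - (2 * Complex.I) • (σ l • A' l)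
        - (1 / 2 : ℂ) • (σ l • u) := by
    rw [show A'' l = -(Complex.I • A' l) by
        rw [hA', smul_smul, Complex.I_mul_I, neg_one_smul, neg_neg],
      show (2 : ℂ) • N' l = (1 / 2 : ℂ) • u - (1 / 2 : ℂ) • Complex.I • C' l by
        rw [hC']; module]
    module
  simp only [e1, ← hC, Finset.sum_add_distrib, Finset.sum_sub_distrib, Finset.sum_neg_distrib,
    ← Finset.smul_sum, ← Finset.sum_smul]
  module

variable {V : Type*} [NormedAddCommGroup V] [InnerProductSpace ℝ V]

/-- The Bochner term of a moment linearization, in terms of number operators `N` and `A`: the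
maps `c` and `A` are the Clifford action and the action on the factor `Λ^{p,0}`. -/
theorem IsMomentLinearization.bochner_eq {ι κ lam : Type*} [Fintype ι] [Fintype κ] [Fintype lam]
    {J D L : V →ₗ[ℝ] V} {v : κ → V} {e : OrthonormalBasis ι ℝ V} {a : ι → ℝ}
    (h : IsMomentLinearization J D L v e a) (f : OrthonormalBasis lam ℝ V) (σ : lam → ℝ)
    (hf : ∀ l, J (L (f l)) = σ l • f l)
    {H : Type*} [AddCommGroup H] [Module ℂ H] {c N : V → Module.End ℂ H}
    {A : V → V → Module.End ℂ H} (hc : IsRealBilinear fun X Y => c X * c Y)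
    (hA : IsRealBilinear A)
    (hcJ : ∀ X, Complex.I • (c (J X) * c X) = (4 : ℂ) • N X - ((‖X‖ ^ 2 : ℝ) : ℂ) • 1)
    (hcJ' : ∀ X, Complex.I • (c X * c (J X)) = -((4 : ℂ) • N X - ((‖X‖ ^ 2 : ℝ) : ℂ) • 1))
    (hAJ : ∀ X, A X (J X) = Complex.I • A X X) :
    (Complex.I / 4) • ∑ j, (c (e j) * c (D (e j)) + (4 : ℂ) • A (e j) (D (e j)))
        - ((1 / 2 : ℂ) * (∑ i, ((‖v i‖ ^ 2 : ℝ) : ℂ) + ∑ l, (σ l : ℂ))) • 1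
        + (1 / 2 : ℂ) • ∑ i, (Complex.I • (c (J (v i)) * c (v i))
            + ((‖v i‖ ^ 2 : ℝ) : ℂ) • 1 - (4 * Complex.I) • A (J (v i)) (v i))
      = ∑ i, ((4 : ℂ) • N (v i) - ((‖v i‖ ^ 2 : ℝ) : ℂ) • 1)
        + ∑ l, (σ l : ℂ) • ((2 : ℂ) • N (f l) + (2 : ℂ) • A (f l) (f l) - 1) := by
  rw [Finset.sum_add_distrib, ← Finset.smul_sum, h.sum_apply f σ hf hc, h.sum_apply f σ hf hA]
  exact bochner_sum_eq _ _ _ _ _ _ _ _ _ _ (fun i => hcJ (v i))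
    (fun l => by simpa [f.norm_eq_one] using hcJ' (f l)) fun l => hAJ (f l)

end Algebra

/-! ### The lower bound for a moment linearization -/

section Bound

variable {V : Type*} [NormedAddCommGroup V] [InnerProductSpace ℝ V] [FiniteDimensional ℝ V]
  {W : Type*} [NormedAddCommGroup W] [InnerProductSpace ℂ W] {J D L : V →ₗ[ℝ] V}
  (hJ : ∀ v, J (J v) = -v)

omit [FiniteDimensional ℝ V] in
theorem isRealBilinear_clifford (p : ℕ) :
    IsRealBilinear fun X Y => clifford J hJ W p X * clifford J hJ W p Y :=
  ⟨fun X Y Z => by rw [clifford_add, add_mul], fun X Y Z => by rw [clifford_add, mul_add],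
    fun r X Y => by rw [clifford_smul, smul_mul_assoc],
    fun r X Y => by rw [clifford_smul, mul_smul_comm]⟩

omit [FiniteDimensional ℝ V] in
theorem isRealBilinear_opA (p : ℕ) : IsRealBilinear (opA J hJ W p) :=
  ⟨opA_add_left hJ W p, opA_add_right hJ W p, opA_smul_left hJ W p, opA_smul_right hJ W p⟩

/-- For unit vectors `2 N` and `2 A` lie between `0` and `1`, so `2 N + 2 A - 1` lies between `-1`
and `1`. The sign of `r` decides which end is used. -/
theorem BoundedBelow.smul_number (hs : ∀ u v, inner ℝ (J u) v = -inner ℝ u (J v)) (p : ℕ)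
    (r : ℝ) {X Y : V} (hX : ‖X‖ = 1) (hY : ‖Y‖ = 1) :
    BoundedBelow (W := W) J hJ p ((r : ℂ) •
      ((2 : ℂ) • liftForms J W p (SpincBochner.number0 J hJ W X) + (2 : ℂ) • opA J hJ W p Y Y - 1)) (-|r|) := by
  rcases le_total 0 r with hr | hr
  · have h := ((((number0 hJ hs p X (W := W)).smul zero_le_two).add
      ((opA_self hJ hs p Y (W := W)).smul zero_le_two)).add (const hJ p (-1))).smul hr
    convert h using 1
    · push_cast
      module
    · rw [abs_of_nonneg hr]; ring
  · have h := ((((sub_number0 hJ hs p X (W := W)).smul zero_le_two).add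
      ((sub_opA_self hJ hs p Y (W := W)).smul zero_le_two)).add (const hJ p (-1))).smul
      (neg_nonneg.2 hr)
    convert h using 1
    · rw [hX, hY]
      push_cast
      module
    · rw [abs_of_nonpos hr]; ring

theorem BoundedBelow.number0_sub (hs : ∀ u v, inner ℝ (J u) v = -inner ℝ u (J v)) (p : ℕ)
    (X : V) :
    BoundedBelow (W := W) J hJ p ((4 : ℂ) • liftForms J W p (SpincBochner.number0 J hJ W X)
      - ((‖X‖ ^ 2 : ℝ) : ℂ) • 1) (-‖X‖ ^ 2) := by
  have h := ((number0 hJ hs p X (W := W)).smul zero_le_four).add (const hJ p (-‖X‖ ^ 2))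
  convert h using 1
  · push_cast
    module
  · ring

theorem IsMomentLinearization.boundedBelow {ι κ : Type*} [Fintype ι] [Fintype κ]
    {v : κ → V} {e : OrthonormalBasis ι ℝ V} {a : ι → ℝ} (h : IsMomentLinearization J D L v e a)
    {DJ : V →ₗ[ℝ] V} (hDJ : DJ = J ∘ₗ D) (p : ℕ) :
    BoundedBelow (W := W) J hJ p
      ((Complex.I / 4) • ∑ j, (clifford J hJ W p (e j) * clifford J hJ W p (D (e j))
            + (4 : ℂ) • opA J hJ W p (e j) (D (e j)))
        - (Complex.I / 2 * trace10 J hJ D DJ) • 1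
        + (1 / 2 : ℂ) • ∑ i, (Complex.I • (clifford J hJ W p (J (v i)) * clifford J hJ W p (v i))
            + ((‖v i‖ ^ 2 : ℝ) : ℂ) • 1 - (4 * Complex.I) • opA J hJ W p (J (v i)) (v i)))
      (-∑ j, |a j|) := by
  obtain ⟨σ, f, hf⟩ : ∃ (σ : Fin (Module.finrank ℝ V) → ℝ)
      (f : OrthonormalBasis (Fin (Module.finrank ℝ V)) ℝ V), ∀ l, J (L (f l)) = σ l • f l :=
    ⟨h.symm.eigenvalues rfl, h.symm.eigenvectorBasis rfl, h.symm.apply_eigenvectorBasis rfl⟩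
  -- `D` has real trace zero because `⟨J X, X⟩ = 0`, so only the trace of `J D`, which is that of
  -- the Hessian, remains.
  have htr : Complex.I / 2 * trace10 J hJ D DJ
      = (1 / 2 : ℂ) * (∑ i, ((‖v i‖ ^ 2 : ℝ) : ℂ) + ∑ l, (σ l : ℂ)) := by
    rw [hDJ, trace10_comp, h.trace_D f σ hf, h.trace_J_comp_D f σ hf]
    push_cast
    linear_combination (-1 / 2 : ℂ) * (∑ i, ((‖v i‖ : ℂ) ^ 2) + ∑ l, (σ l : ℂ)) * Complex.I_mul_I
  have hle := h.sum_abs_le f σ hf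
  have hbound : BoundedBelow (W := W) J hJ p
      (∑ i, ((4 : ℂ) • liftForms J W p (number0 J hJ W (v i)) - ((‖v i‖ ^ 2 : ℝ) : ℂ) • 1)
        + ∑ l, (σ l : ℂ) • ((2 : ℂ) • liftForms J W p (number0 J hJ W (f l))
          + (2 : ℂ) • opA J hJ W p (f l) (f l) - 1))
      (∑ i, -‖v i‖ ^ 2 + ∑ l, -|σ l|) :=
    (BoundedBelow.sum fun i _ => BoundedBelow.number0_sub hJ h.skew p (v i)).add
      (BoundedBelow.sum fun l _ =>
        BoundedBelow.smul_number hJ h.skew p (σ l) (f.norm_eq_one l) (f.norm_eq_one l))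
  rw [htr, h.bochner_eq f σ hf (isRealBilinear_clifford hJ p) (isRealBilinear_opA hJ p)
    (I_smul_clifford_J_mul_clifford hJ W h.skew p) (I_smul_clifford_mul_clifford_J hJ W h.skew p)
    fun X => opA_J_right hJ W p X X]
  refine hbound.mono ?_
  rw [Finset.sum_neg_distrib, Finset.sum_neg_distrib]
  linarith

end Bound

end SpincBochner

namespace SpincBochner

/-! ### The second derivative of a function with a diagonal expansion -/

section Calculus

variable {E : Type*} [NormedAddCommGroup E] [NormedSpace ℝ E]

/-- If the second derivative `c` along `v` were positive, subtracting a small multiple of `t²` would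
still leave a strict second derivative test at `0`, so `f (u + t v) - f u` would dominate a positive
multiple of `t²`, contrary to the cubic bound. -/
theorem fderiv_fderiv_apply_self_nonpos {f : E → ℝ} {u : E} (hf : ContDiffAt ℝ 2 f u)
    (h0 : fderiv ℝ f u = 0) (h : (fun z => f z - f u) =O[𝓝 u] fun z => ‖z - u‖ ^ 3) (v : E) :
    fderiv ℝ (fderiv ℝ f) u v v ≤ 0 := by
  by_contra! hpos
  set c := fderiv ℝ (fderiv ℝ f) u v v with hc
  have hline (t : ℝ) : HasDerivAt (fun t : ℝ => u + t • v) v t := by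
    simpa using ((hasDerivAt_id t).smul_const v).const_add u
  have hu : u + (0 : ℝ) • v = u := by simp
  have hcont : Filter.Tendsto (fun t : ℝ => u + t • v) (𝓝 0) (𝓝 u) := by
    have := (hline 0).continuousAt.tendsto
    rwa [hu] at this
  have hdiff : ∀ᶠ z in 𝓝 u, DifferentiableAt ℝ f z :=
    (hf.eventually (by simp)).mono fun z hz => hz.differentiableAt (by simp)
  -- Any coefficient strictly between `0` and `c / 2` would do; `c / 4` leaves the second derivative
  -- `c / 2 > 0`.
  have hd : deriv (fun t : ℝ => f (u + t • v) - c / 4 * t ^ 2) =ᶠ[𝓝 0]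
      fun t => fderiv ℝ f (u + t • v) v - c / 2 * t := by
    have : ∀ᶠ t : ℝ in 𝓝 0, DifferentiableAt ℝ f (u + t • v) :=
      hcont.eventually hdiff
    filter_upwards [this] with t ht
    have h1 := ht.hasFDerivAt.comp_hasDerivAt t (hline t)
    have h2 := ((hasDerivAt_id t).pow 2).const_mul (c / 4)
    refine ((h1.sub h2).congr_deriv ?_).deriv
    simp
    ring
  have hf1 : DifferentiableAt ℝ (fderiv ℝ f) u :=
    (hf.fderiv_right (m := 1) (by norm_num)).differentiableAt (by simp)
  have hf' : HasFDerivAt (fun z => fderiv ℝ f z v) ((fderiv ℝ (fderiv ℝ f) u).flip v)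
      (u + (0 : ℝ) • v) := by
    rw [hu]
    simpa using hf1.hasFDerivAt.clm_apply (hasFDerivAt_const v u)
  have hdd : deriv (deriv fun t : ℝ => f (u + t • v) - c / 4 * t ^ 2) 0 = c - c / 2 := by
    rw [hd.deriv_eq]
    have h1 := (hf'.comp_hasDerivAt 0 (hline 0)).sub
      ((hasDerivAt_id (0 : ℝ)).const_mul (c / 2))
    refine (h1.congr_deriv ?_).deriv
    simp [hc]
  have hmin := isLocalMin_of_deriv_deriv_pos (f := fun t : ℝ => f (u + t • v) - c / 4 * t ^ 2)
    (x₀ := 0) (by rw [hdd]; linarith) (by rw [hd.eq_of_nhds]; simp [h0]) (by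
      refine ContinuousAt.sub ?_ (by fun_prop)
      rw [ContinuousAt, hu]
      exact hf.continuousAt.tendsto.comp hcont)
  obtain ⟨C, hC⟩ := h.bound
  have hC' : ∀ᶠ t : ℝ in 𝓝 0, ‖f (u + t • v) - f u‖ ≤ C * ‖‖u + t • v - u‖ ^ 3‖ :=
    hcont.eventually hC
  have hev : ∀ᶠ t : ℝ in 𝓝 0, t ^ 2 * (c / 4) ≤ t ^ 2 * (C * ‖v‖ ^ 3 * |t|) := by
    filter_upwards [hmin, hC'] with t h1 h2
    simp only [hu, zero_pow two_ne_zero, mul_zero, sub_zero] at h1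
    rw [add_sub_cancel_left, norm_smul, norm_pow, norm_mul, norm_norm, norm_norm,
      Real.norm_eq_abs t, Real.norm_eq_abs] at h2
    have h3 := (le_abs_self _).trans h2
    have h4 : |t| ^ 3 = t ^ 2 * |t| := by rw [pow_succ, sq_abs]
    rw [mul_pow, h4] at h3
    nlinarith
  have hlim : Filter.Tendsto (fun t : ℝ => C * ‖v‖ ^ 3 * |t|) (𝓝[≠] 0) (𝓝 0) := by
    have : Continuous fun t : ℝ => C * ‖v‖ ^ 3 * |t| := by fun_prop
    have := this.tendsto 0
    rw [abs_zero, mul_zero] at this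
    exact this.mono_left nhdsWithin_le_nhds
  -- Divide by `t²` and let `t` tend to `0`.
  have hle : c / 4 ≤ 0 := by
    refine ge_of_tendsto hlim ?_
    filter_upwards [nhdsWithin_le_nhds hev, self_mem_nhdsWithin] with t h1 h2
    exact le_of_mul_le_mul_left h1 (sq_pos_of_ne_zero h2)
  linarith

/-- The preceding bound for `f` and `-f` kills the diagonal of the second derivative; polarization
does the rest. -/
theorem fderiv_fderiv_eq_zero_of_isBigO {f : E → ℝ} {u : E} (hf : ContDiffAt ℝ 2 f u)
    (h : (fun z => f z - f u) =O[𝓝 u] fun z => ‖z - u‖ ^ 3) :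
    fderiv ℝ (fderiv ℝ f) u = 0 := by
  have h0 : fderiv ℝ f u = 0 := by
    refine HasFDerivAt.fderiv (HasFDerivAt.of_isLittleO ?_)
    have h1 : (fun z : E => ‖z - u‖ ^ 3) =o[𝓝 u] fun z => z - u := by
      have : (fun x : E => ‖x‖ ^ 3) =o[𝓝 0] fun x => x :=
        Asymptotics.isLittleO_norm_pow_id (by norm_num)
      have h2 : Filter.Tendsto (fun z => z - u) (𝓝 u) (𝓝 0) :=
        tendsto_sub_nhds_zero_iff.2 Filter.tendsto_id
      exact this.comp_tendsto h2
    simpa using h.trans_isLittleO h1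
  have hdiag (v : E) : fderiv ℝ (fderiv ℝ f) u v v = 0 := by
    refine le_antisymm (fderiv_fderiv_apply_self_nonpos hf h0 h v) ?_
    have hneg : (fun z => -f z - -f u) =O[𝓝 u] fun z => ‖z - u‖ ^ 3 := by
      refine h.neg_left.congr_left fun z => ?_
      ring
    have e : fderiv ℝ (fun z => -f z) = fun z => -fderiv ℝ f z := by
      funext z; exact fderiv_fun_neg
    have := fderiv_fderiv_apply_self_nonpos (f := fun z => -f z) hf.neg (by simp [h0]) hneg v
    rw [e, fderiv_fun_neg] at this
    simpa using this
  have hsymm := hf.isSymmSndFDerivAt (by simp)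
  ext v w
  have h1 := hdiag (v + w)
  simp only [map_add, add_apply, hdiag, hsymm w v] at h1
  simp only [zero_apply]
  linarith

/-- Second derivatives of `g` enter only multiplied by `g`, which vanishes at `u`. This is why the
coordinates in the expansion matter only to first order. -/
theorem fderiv_fderiv_sum_mul_sq {ι : Type*} [Fintype ι] {g : E → EuclideanSpace ℝ ι} {u : E}
    (hg : ContDiffAt ℝ 2 g u) (hg0 : g u = 0) (a : ι → ℝ) (v w : E) :
    fderiv ℝ (fderiv ℝ fun z => ∑ j, a j * g z j ^ 2) u v w
      = ∑ j, 2 * a j * (fderiv ℝ g u v j * fderiv ℝ g u w j) := by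
  set G : ι → E → ℝ := fun j z => g z j with hG
  have hGc (j : ι) : ContDiffAt ℝ 2 (G j) u :=
    (EuclideanSpace.proj j : EuclideanSpace ℝ ι →L[ℝ] ℝ).contDiff.contDiffAt.comp u hg
  have hGu (j : ι) (v : E) : fderiv ℝ (G j) u v = fderiv ℝ g u v j := by
    have := (EuclideanSpace.proj j : EuclideanSpace ℝ ι →L[ℝ] ℝ).hasFDerivAt.comp u
      (hg.differentiableAt (by simp)).hasFDerivAt
    rw [show G j = (EuclideanSpace.proj j : EuclideanSpace ℝ ι →L[ℝ] ℝ) ∘ g from rfl, this.fderiv]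
    rfl
  have hdiff : ∀ᶠ z in 𝓝 u, ∀ j, DifferentiableAt ℝ (G j) z :=
    Filter.eventually_all.2 fun j =>
      ((hGc j).eventually (by simp)).mono fun z hz => hz.differentiableAt (by simp)
  have hd : fderiv ℝ (fun z => ∑ j, a j * g z j ^ 2) =ᶠ[𝓝 u]
      fun z => ∑ j, (2 * a j * G j z) • fderiv ℝ (G j) z := by
    filter_upwards [hdiff] with z hz
    refine (HasFDerivAt.fun_sum fun j _ =>
      (((hz j).hasFDerivAt.pow 2).const_mul (a j))).fderiv.trans ?_
    refine Finset.sum_congr rfl fun j _ => ?_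
    rw [smul_smul]
    congr 1
    simp
    ring
  rw [hd.fderiv_eq]
  have h1 (j : ι) := (((hGc j).differentiableAt (by simp)).hasFDerivAt.const_mul (2 * a j)).smul
    (((hGc j).fderiv_right (m := 1) (by norm_num)).differentiableAt (by simp)).hasFDerivAt
  have h2 := HasFDerivAt.fun_sum fun j (_ : j ∈ Finset.univ) => h1 j
  have hG0 (j : ι) : G j u = 0 := by simp [hG, hg0]
  refine (DFunLike.congr_fun (DFunLike.congr_fun h2.fderiv v) w).trans ?_
  simp [hG0, hGu, mul_assoc]

/-- Since `g` is differentiable with `g u = 0`, the error `O(‖g‖³)` is `O(‖z - u‖³)`, so `f` and the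
quadratic part have the same second derivative. -/
theorem fderiv_fderiv_of_expansion {ι : Type*} [Fintype ι] {f : E → ℝ}
    {g : E → EuclideanSpace ℝ ι} {u : E} (hf : ContDiffAt ℝ 2 f u) (hg : ContDiffAt ℝ 2 g u)
    (hg0 : g u = 0) (a : ι → ℝ)
    (h : (fun z => f z - f u - ∑ j, a j * g z j ^ 2) =O[𝓝 u] fun z => ‖g z‖ ^ 3) (v w : E) :
    fderiv ℝ (fderiv ℝ f) u v w = ∑ j, 2 * a j * (fderiv ℝ g u v j * fderiv ℝ g u w j) := by
  set q : E → ℝ := fun z => ∑ j, a j * g z j ^ 2 with hq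
  have hqc : ContDiffAt ℝ 2 q u := by
    refine ContDiffAt.sum fun j _ => contDiffAt_const.mul (ContDiffAt.pow ?_ 2)
    exact (EuclideanSpace.proj j : EuclideanSpace ℝ ι →L[ℝ] ℝ).contDiff.contDiffAt.comp u hg
  have hq0 : q u = 0 := by simp [hq, hg0]
  have hO : g =O[𝓝 u] fun z => z - u := by
    have := (hg.differentiableAt (by simp)).isBigO_sub
    simpa [hg0] using this
  have hz := fderiv_fderiv_eq_zero_of_isBigO (f := fun z => f z - q z) (hf.sub hqc) (by
    refine (h.trans (hO.norm_norm.pow 3)).congr_left fun z => ?_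
    rw [hq0]
    ring)
  have hev : fderiv ℝ (fun z => f z - q z) =ᶠ[𝓝 u] fun z => fderiv ℝ f z - fderiv ℝ q z := by
    filter_upwards [hf.eventually (by simp), hqc.eventually (by simp)] with z h1 h2
    exact fderiv_fun_sub (h1.differentiableAt (by simp)) (h2.differentiableAt (by simp))
  rw [hev.fderiv_eq, fderiv_fun_sub
    ((hf.fderiv_right (m := 1) (by norm_num)).differentiableAt (by simp))
    ((hqc.fderiv_right (m := 1) (by norm_num)).differentiableAt (by simp)), sub_eq_zero] at hz
  rw [hz, fderiv_fderiv_sum_mul_sq hg hg0]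

end Calculus

end SpincBochner

namespace SpincBochner

/-! ### Covariant derivatives at a zero of a vector field -/

section CovariantDerivative

variable {m : ℕ} {M : Type*} [TopologicalSpace M] [ChartedSpace (EuclideanSpace ℝ (Fin m)) M]
  [IsManifold (𝓡 m) ∞ M]
  (cov : CovariantDerivative (𝓡 m) (EuclideanSpace ℝ (Fin m))
      (fun x : M => TangentSpace (𝓡 m) x))

/-- The vector field `σ` is differentiable at `x`. -/
abbrev MDiffFieldAt (σ : Π z : M, TangentSpace (𝓡 m) z) (x : M) : Prop :=
  MDifferentiableAt (𝓡 m) (𝓡 m).tangent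
    (fun z => TotalSpace.mk' (EuclideanSpace ℝ (Fin m)) z (σ z)) x

/-- At a zero of a vector field, every first order operator on vector fields that satisfies the same
Leibniz rule as `R ∘ ∇_v` agrees with it. -/
theorem eq_apply_cov_of_leibniz {x : M} (v : TangentSpace (𝓡 m) x) {A : Type*} [AddCommGroup A]
    [Module ℝ A] (R : TangentSpace (𝓡 m) x →ₗ[ℝ] A) (Ψ : (Π z : M, TangentSpace (𝓡 m) z) → A)
    (hadd : ∀ σ τ : Π z : M, TangentSpace (𝓡 m) z, MDiffFieldAt σ x → MDiffFieldAt τ x →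
      Ψ (σ + τ) = Ψ σ + Ψ τ)
    (hsmul : ∀ (f : M → ℝ) (σ : Π z : M, TangentSpace (𝓡 m) z),
      MDifferentiableAt (𝓡 m) 𝓘(ℝ, ℝ) f x → MDiffFieldAt σ x →
      Ψ (f • σ) = f x • Ψ σ + mvfderiv (𝓡 m) f x v • R (σ x))
    {σ : Π z : M, TangentSpace (𝓡 m) z} (hσ : MDiffFieldAt σ x) (h0 : σ x = 0) :
    Ψ σ = R (cov σ x v) := by
  -- The two terms with the derivative of the coefficient function cancel, so the difference is
  -- tensorial and depends only on the value at `x`.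
  have ht : TensorialAt (𝓡 m) (EuclideanSpace ℝ (Fin m))
      (fun τ : (Π z : M, TangentSpace (𝓡 m) z) => Ψ τ - R (cov τ x v)) x := by
    constructor
    · intro f τ hf hτ
      have h1 := cov.isCovariantDerivativeOnUniv.leibniz hτ hf (Set.mem_univ x)
      simp only [h1, hsmul f τ hf hτ]
      simp only [add_apply, smul_apply, ContinuousLinearMap.smulRight_apply, map_add, map_smul,
        smul_sub]
      abel
    · intro τ τ' hτ hτ'
      have h1 := cov.isCovariantDerivativeOnUniv.add hτ hτ' (Set.mem_univ x)
      simp only [h1, hadd τ τ' hτ hτ']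
      simp only [add_apply, map_add]
      abel
  have h1 := ht.pointwise (σ' := 0) hσ (mdifferentiableAt_zeroSection ..) h0
  have h2 := ht.zero
  exact sub_eq_zero.1 (h1.trans h2)

/-- The term `(∇J) σ` drops out where `σ` vanishes, so no parallelism of `J` is needed. This gives
`∇(J X^H) = J ∇X^H` at the critical point. -/
theorem cov_clm_apply_of_eq_zero {x : M}
    {J : Π x : M, TangentSpace (𝓡 m) x →L[ℝ] TangentSpace (𝓡 m) x}
    (hJ : MDifferentiableAt (𝓡 m)
      ((𝓡 m).prod 𝓘(ℝ, EuclideanSpace ℝ (Fin m) →L[ℝ] EuclideanSpace ℝ (Fin m)))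
      (fun x => TotalSpace.mk' (EuclideanSpace ℝ (Fin m) →L[ℝ] EuclideanSpace ℝ (Fin m))
        (E := fun x : M => TangentSpace (𝓡 m) x →L[ℝ] TangentSpace (𝓡 m) x) x (J x)) x)
    {σ : Π z : M, TangentSpace (𝓡 m) z} (hσ : MDiffFieldAt σ x) (h0 : σ x = 0)
    (v : TangentSpace (𝓡 m) x) :
    cov (fun z => J z (σ z)) x v = J x (cov σ x v) := by
  have hJσ (τ : Π z : M, TangentSpace (𝓡 m) z) (hτ : MDiffFieldAt τ x) :
      MDiffFieldAt (fun z => J z (τ z)) x := hJ.clm_bundle_apply hτ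
  refine eq_apply_cov_of_leibniz cov v (J x).toLinearMap (fun τ => cov (fun z => J z (τ z)) x v)
    (fun τ τ' hτ hτ' => ?_) (fun f τ hf hτ => ?_) hσ h0
  · have h1 := cov.isCovariantDerivativeOnUniv.add (hJσ τ hτ) (hJσ τ' hτ') (Set.mem_univ x)
    have h2 : (fun z => J z ((τ + τ') z)) = (fun z => J z (τ z)) + fun z => J z (τ' z) := by
      funext z
      simp
    simp only [h2, h1, add_apply]
  · have h1 := cov.isCovariantDerivativeOnUniv.leibniz (hJσ τ hτ) hf (Set.mem_univ x)
    have h2 : (fun z => J z ((f • τ) z)) = f • fun z => J z (τ z) := by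
      funext z
      simp
    simp only [h2, h1]
    rfl

theorem mdifferentiableAt_bilin {x : M}
    {Ω : Π x : M, TangentSpace (𝓡 m) x →L[ℝ] TangentSpace (𝓡 m) x →L[ℝ] ℝ}
    (hΩ : MDifferentiableAt (𝓡 m)
      ((𝓡 m).prod 𝓘(ℝ, EuclideanSpace ℝ (Fin m) →L[ℝ] EuclideanSpace ℝ (Fin m) →L[ℝ] ℝ))
      (fun x => TotalSpace.mk' (EuclideanSpace ℝ (Fin m) →L[ℝ] EuclideanSpace ℝ (Fin m) →L[ℝ] ℝ)
        (E := fun x : M => TangentSpace (𝓡 m) x →L[ℝ] TangentSpace (𝓡 m) x →L[ℝ] ℝ) x (Ω x)) x)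
    {σ τ : Π z : M, TangentSpace (𝓡 m) z} (hσ : MDiffFieldAt σ x) (hτ : MDiffFieldAt τ x) :
    MDifferentiableAt (𝓡 m) 𝓘(ℝ, ℝ) (fun z => Ω z (σ z) (τ z)) x := by
  have := MDifferentiableAt.clm_bundle_apply₂ (F₃ := ℝ) (E₃ := Bundle.Trivial M ℝ) hΩ hσ hτ
  simpa [mdifferentiableAt_section] using this

/-- The derivatives of `Ω` and of `τ` both come paired with `σ x = 0`. -/
theorem mvfderiv_bilin_of_eq_zero {x : M}
    {Ω : Π x : M, TangentSpace (𝓡 m) x →L[ℝ] TangentSpace (𝓡 m) x →L[ℝ] ℝ}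
    (hΩ : MDifferentiableAt (𝓡 m)
      ((𝓡 m).prod 𝓘(ℝ, EuclideanSpace ℝ (Fin m) →L[ℝ] EuclideanSpace ℝ (Fin m) →L[ℝ] ℝ))
      (fun x => TotalSpace.mk' (EuclideanSpace ℝ (Fin m) →L[ℝ] EuclideanSpace ℝ (Fin m) →L[ℝ] ℝ)
        (E := fun x : M => TangentSpace (𝓡 m) x →L[ℝ] TangentSpace (𝓡 m) x →L[ℝ] ℝ) x (Ω x)) x)
    {σ τ : Π z : M, TangentSpace (𝓡 m) z} (hσ : MDiffFieldAt σ x) (hτ : MDiffFieldAt τ x)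
    (h0 : σ x = 0) (v : TangentSpace (𝓡 m) x) :
    mvfderiv (𝓡 m) (fun z => Ω z (σ z) (τ z)) x v = Ω x (cov σ x v) (τ x) := by
  let R : TangentSpace (𝓡 m) x →ₗ[ℝ] ℝ :=
    { toFun := fun u => Ω x u (τ x)
      map_add' := fun u w => by simp
      map_smul' := fun c u => by simp }
  refine eq_apply_cov_of_leibniz cov v R
    (fun σ => mvfderiv (𝓡 m) (fun z => Ω z (σ z) (τ z)) x v)
    (fun σ σ' hσ hσ' => ?_) (fun f σ hf hσ => ?_) hσ h0
  · have h2 : (fun z => Ω z ((σ + σ') z) (τ z))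
        = (fun z => Ω z (σ z) (τ z)) + fun z => Ω z (σ' z) (τ z) := by
      funext z
      simp
    rw [h2, mvfderiv_add (mdifferentiableAt_bilin hΩ hσ hτ) (mdifferentiableAt_bilin hΩ hσ' hτ)]
    rfl
  · have h2 : (fun z => Ω z ((f • σ) z) (τ z)) = f * fun z => Ω z (σ z) (τ z) := by
      funext z
      simp
    rw [h2, mvfderiv_mul hf (mdifferentiableAt_bilin hΩ hσ hτ)]
    simp [R, mul_comm]

end CovariantDerivative

end SpincBochner

namespace SpincBochner

/-! ### Derivatives in a chart, and the Hessian of a Hamiltonian -/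

section Charts

variable {m : ℕ} {M : Type*} [TopologicalSpace M] [ChartedSpace (EuclideanSpace ℝ (Fin m)) M]

theorem two_le_smooth : (2 : ℕ∞ω) ≤ ∞ := by
  have h : ((2 : ℕ∞) : ℕ∞ω) ≤ ((⊤ : ℕ∞) : ℕ∞ω) := WithTop.coe_le_coe.2 le_top
  exact h

theorem mvfderiv_eq_fderiv_chart {F : Type*} [NormedAddCommGroup F] [NormedSpace ℝ F] {x : M}
    {g : M → F} (hg : MDifferentiableAt (𝓡 m) 𝓘(ℝ, F) g x)
    {h : EuclideanSpace ℝ (Fin m) → F}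
    (hgh : ∀ᶠ u in 𝓝 (extChartAt (𝓡 m) x x), g ((extChartAt (𝓡 m) x).symm u) = h u)
    (v : EuclideanSpace ℝ (Fin m)) :
    mvfderiv (𝓡 m) g x v = fderiv ℝ h (extChartAt (𝓡 m) x x) v := by
  have h1 := hg.mvfderiv
  rw [h1]
  have h2 : Set.range (𝓡 m) = Set.univ := ModelWithCorners.Boundaryless.range_eq_univ
  rw [h2, fderivWithin_univ]
  have h3 : writtenInExtChartAt (𝓡 m) 𝓘(ℝ, F) x g =ᶠ[𝓝 (extChartAt (𝓡 m) x x)] h := by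
    filter_upwards [hgh] with u hu
    exact hu
  rw [h3.fderiv_eq]
  rfl

theorem contDiffAt_chart {F : Type*} [NormedAddCommGroup F] [NormedSpace ℝ F] {x : M}
    {g : M → F} {n : ℕ∞ω} (hg : ContMDiffAt (𝓡 m) 𝓘(ℝ, F) n g x) :
    ContDiffAt ℝ n (g ∘ (extChartAt (𝓡 m) x).symm) (extChartAt (𝓡 m) x x) := by
  have h := (contMDiffAt_iff.1 hg).2
  have h2 : Set.range (𝓡 m) = Set.univ := ModelWithCorners.Boundaryless.range_eq_univ
  rw [h2, contDiffWithinAt_univ] at h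
  exact h

variable [IsManifold (𝓡 m) ∞ M]

/-- The vector field near `x` with constant coordinates `w` in the chart at `x`. -/
noncomputable def coordField (x : M) (w : EuclideanSpace ℝ (Fin m)) (z : M) :
    TangentSpace (𝓡 m) z :=
  (trivializationAt (EuclideanSpace ℝ (Fin m)) (TangentSpace (𝓡 m)) x).symmL ℝ z w

theorem coordField_eq_mfderiv (x : M) (w : EuclideanSpace ℝ (Fin m)) {z : M}
    (hz : z ∈ (chartAt (EuclideanSpace ℝ (Fin m)) x).source) :
    coordField x w z
      = mfderiv 𝓘(ℝ, EuclideanSpace ℝ (Fin m)) (𝓡 m) (extChartAt (𝓡 m) x).symm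
          (extChartAt (𝓡 m) x z) w := by
  rw [coordField, TangentBundle.symmL_trivializationAt hz]
  have h2 : Set.range (𝓡 m) = Set.univ := ModelWithCorners.Boundaryless.range_eq_univ
  rw [h2, mfderivWithin_univ]
  rfl

theorem coordField_self (x : M) (w : EuclideanSpace ℝ (Fin m)) : coordField x w x = w := by
  rw [coordField, TangentBundle.symmL_trivializationAt (mem_chart_source _ x),
    mfderivWithin_range_extChartAt_symm]
  rfl

theorem mdiffFieldAt_coordField (x : M) (w : EuclideanSpace ℝ (Fin m)) :
    MDiffFieldAt (coordField (M := M) x w) x := by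
  rw [MDiffFieldAt, mdifferentiableAt_section]
  refine (mdifferentiableAt_const (c := w)).congr_of_eventuallyEq ?_
  filter_upwards [(trivializationAt (EuclideanSpace ℝ (Fin m)) (TangentSpace (𝓡 m))
    x).open_baseSet.mem_nhds (FiberBundle.mem_baseSet_trivializationAt' x)] with z hz
  rw [coordField, Trivialization.symmL_apply, Trivialization.apply_mk_symm _ hz]
  exact hz

theorem mvfderiv_coordField {x z : M} (hz : z ∈ (chartAt (EuclideanSpace ℝ (Fin m)) x).source)
    {F : Type*} [NormedAddCommGroup F] [NormedSpace ℝ F]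
    {f : M → F} (hf : MDifferentiableAt (𝓡 m) 𝓘(ℝ, F) f z) (w : EuclideanSpace ℝ (Fin m)) :
    mvfderiv (𝓡 m) f z (coordField x w z)
      = fderiv ℝ (f ∘ (extChartAt (𝓡 m) x).symm) (extChartAt (𝓡 m) x z) w := by
  have hz' : z ∈ (extChartAt (𝓡 m) x).source := by rwa [extChartAt_source]
  have hzz : (extChartAt (𝓡 m) x).symm (extChartAt (𝓡 m) x z) = z :=
    (extChartAt (𝓡 m) x).left_inv hz'
  have h1 : MDifferentiableAt 𝓘(ℝ, EuclideanSpace ℝ (Fin m)) (𝓡 m) (extChartAt (𝓡 m) x).symm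
      (extChartAt (𝓡 m) x z) := by
    have := mdifferentiableWithinAt_extChartAt_symm (I := 𝓡 m) (x := x)
      ((extChartAt (𝓡 m) x).map_source hz')
    have h2 : Set.range (𝓡 m) = Set.univ := ModelWithCorners.Boundaryless.range_eq_univ
    rwa [h2, mdifferentiableWithinAt_univ] at this
  rw [coordField_eq_mfderiv x w hz, ← mfderiv_eq_fderiv]
  rw [mfderiv_comp_of_eq (x := extChartAt (𝓡 m) x z) hf h1 hzz]
  rw [hzz]
  rfl

/-- At a zero of the Hamiltonian vector field `X` of `f`, the form `Ω(∇X, ·)` is the Hessian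
of `f`. -/
theorem bilin_cov_eq_hessian
    (cov : CovariantDerivative (𝓡 m) (EuclideanSpace ℝ (Fin m))
      (fun x : M => TangentSpace (𝓡 m) x)) {x : M}
    {Ω : Π x : M, TangentSpace (𝓡 m) x →L[ℝ] TangentSpace (𝓡 m) x →L[ℝ] ℝ}
    (hΩ : MDifferentiableAt (𝓡 m)
      ((𝓡 m).prod 𝓘(ℝ, EuclideanSpace ℝ (Fin m) →L[ℝ] EuclideanSpace ℝ (Fin m) →L[ℝ] ℝ))
      (fun x => TotalSpace.mk' (EuclideanSpace ℝ (Fin m) →L[ℝ] EuclideanSpace ℝ (Fin m) →L[ℝ] ℝ)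
        (E := fun x : M => TangentSpace (𝓡 m) x →L[ℝ] TangentSpace (𝓡 m) x →L[ℝ] ℝ) x (Ω x)) x)
    {f : M → ℝ} (hf : ContMDiff (𝓡 m) 𝓘(ℝ, ℝ) ∞ f) {X : Π x : M, TangentSpace (𝓡 m) x}
    (hX : IsHamiltonianVectorField Ω f X) (hXd : MDiffFieldAt X x) (h0 : X x = 0)
    (v w : EuclideanSpace ℝ (Fin m)) :
    Ω x (cov X x v) w = fderiv ℝ (fderiv ℝ (f ∘ (extChartAt (𝓡 m) x).symm))
      (extChartAt (𝓡 m) x x) v w := by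
  have h1 := mvfderiv_bilin_of_eq_zero cov hΩ hXd (mdiffFieldAt_coordField x w) h0 v
  rw [coordField_self] at h1
  rw [← h1]
  -- Near `x`, pairing `X` with a coordinate field gives a partial derivative of `f`;
  -- differentiating once more gives its second derivative in the chart.
  have h2 := mvfderiv_eq_fderiv_chart
    (mdifferentiableAt_bilin hΩ hXd (mdiffFieldAt_coordField x w))
    (h := fun u => fderiv ℝ (f ∘ (extChartAt (𝓡 m) x).symm) u w) (by
      filter_upwards [extChartAt_target_mem_nhds (I := 𝓡 m) x] with u hu
      rw [hX, mvfderiv_coordField, (extChartAt (𝓡 m) x).right_inv hu]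
      · rw [← extChartAt_source (𝓡 m)]
        exact (extChartAt (𝓡 m) x).map_target hu
      · exact hf.mdifferentiable (by simp) _) v
  rw [h2]
  have h3 : DifferentiableAt ℝ (fderiv ℝ (f ∘ (extChartAt (𝓡 m) x).symm))
      (extChartAt (𝓡 m) x x) :=
    ((contDiffAt_chart ((hf x).of_le (m := 2) two_le_smooth)).fderiv_right
      (m := 1) (by norm_num)).differentiableAt (by simp)
  have h4 := h3.hasFDerivAt.clm_apply (hasFDerivAt_const w (extChartAt (𝓡 m) x x))
  rw [h4.fderiv]
  simp

end Charts

end SpincBochner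

namespace SpincBochner

/-! ### The action in charts -/

section GroupAction

variable {m k : ℕ} {M : Type*} [TopologicalSpace M] [ChartedSpace (EuclideanSpace ℝ (Fin m)) M]
  [IsManifold (𝓡 m) ∞ M]

theorem continuousLinearMapAt_eq_mvfderiv {x z : M}
    (hz : z ∈ (chartAt (EuclideanSpace ℝ (Fin m)) x).source) (v : TangentSpace (𝓡 m) z) :
    (trivializationAt (EuclideanSpace ℝ (Fin m)) (TangentSpace (𝓡 m)) x).continuousLinearMapAt ℝ z v
      = mvfderiv (𝓡 m) (extChartAt (𝓡 m) x) z v := by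
  rw [TangentBundle.continuousLinearMapAt_trivializationAt hz]
  rfl

theorem continuousLinearMapAt_self (x : M) (v : TangentSpace (𝓡 m) x) :
    (trivializationAt (EuclideanSpace ℝ (Fin m)) (TangentSpace (𝓡 m)) x).continuousLinearMapAt ℝ x v
      = v := by
  rw [TangentBundle.continuousLinearMapAt_trivializationAt (mem_chart_source _ x),
    mfderiv_extChartAt_self]
  rfl

theorem mdifferentiableAt_coord_iff {x : M} {σ : Π z : M, TangentSpace (𝓡 m) z} :
    MDiffFieldAt σ x ↔ MDifferentiableAt (𝓡 m) 𝓘(ℝ, EuclideanSpace ℝ (Fin m)) (fun z =>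
      (trivializationAt (EuclideanSpace ℝ (Fin m)) (TangentSpace (𝓡 m)) x).continuousLinearMapAt ℝ z
        (σ z)) x := by
  rw [MDiffFieldAt, mdifferentiableAt_section]
  refine Filter.EventuallyEq.mdifferentiableAt_iff ?_
  filter_upwards [(trivializationAt (EuclideanSpace ℝ (Fin m)) (TangentSpace (𝓡 m))
    x).open_baseSet.mem_nhds (FiberBundle.mem_baseSet_trivializationAt' x)] with z hz
  rw [Trivialization.continuousLinearMapAt_apply, Trivialization.linearMapAt_apply, if_pos hz]

/-- At a zero, the covariant derivative is the derivative of the coordinates. -/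
theorem cov_eq_mvfderiv_coord (cov : CovariantDerivative (𝓡 m) (EuclideanSpace ℝ (Fin m))
      (fun x : M => TangentSpace (𝓡 m) x)) {x : M} {σ : Π z : M, TangentSpace (𝓡 m) z}
    (hσ : MDiffFieldAt σ x) (h0 : σ x = 0) (v : TangentSpace (𝓡 m) x) :
    cov σ x v = mvfderiv (𝓡 m) (fun z =>
      (trivializationAt (EuclideanSpace ℝ (Fin m)) (TangentSpace (𝓡 m)) x).continuousLinearMapAt ℝ z
        (σ z)) x v := by
  symm
  refine eq_apply_cov_of_leibniz cov v (LinearMap.id : EuclideanSpace ℝ (Fin m) →ₗ[ℝ] _)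
    (fun σ => mvfderiv (𝓡 m) (fun z =>
      (trivializationAt (EuclideanSpace ℝ (Fin m)) (TangentSpace (𝓡 m)) x).continuousLinearMapAt ℝ z
        (σ z)) x v)
    (fun σ τ hσ hτ => ?_) (fun f σ hf hσ => ?_) hσ h0
  · rw [mdifferentiableAt_coord_iff] at hσ hτ
    simp only [Pi.add_apply, map_add]
    exact congrArg (· v) (mvfderiv_add hσ hτ)
  · rw [mdifferentiableAt_coord_iff] at hσ
    simp only [Pi.smul_apply', map_smul]
    have := congrArg (· v) (mvfderiv_smul hf hσ)
    simp only [continuousLinearMapAt_self] at this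
    exact this

variable {G : Type*} [TopologicalSpace G] [ChartedSpace (EuclideanSpace ℝ (Fin k)) G] [Group G]
  [LieGroup (𝓡 k) ∞ G] [MulAction G M] [ContMDiffSMul (𝓡 k) (𝓡 m) ∞ G M]

omit [LieGroup (𝓡 k) ∞ G] [ContMDiffSMul (𝓡 k) (𝓡 m) ∞ G M] [IsManifold (𝓡 m) ∞ M] in
variable (G) in
/-- The action in the charts at `1` and `x`. -/
noncomputable def actionChart (x : M)
    (q : EuclideanSpace ℝ (Fin k) × EuclideanSpace ℝ (Fin m)) : EuclideanSpace ℝ (Fin m) :=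
  extChartAt (𝓡 m) x ((extChartAt (𝓡 k) (1 : G)).symm q.1 • (extChartAt (𝓡 m) x).symm q.2)

theorem contDiffAt_actionChart (x : M) :
    ContDiffAt ℝ 2 (actionChart G x)
      (extChartAt (𝓡 k) (1 : G) 1, extChartAt (𝓡 m) x x) := by
  rw [← contMDiffAt_iff_contDiffAt]
  have h1 : ContMDiffAt 𝓘(ℝ, EuclideanSpace ℝ (Fin k)) (𝓡 k) ∞ (extChartAt (𝓡 k) (1 : G)).symm
      (extChartAt (𝓡 k) (1 : G) 1) :=
    (contMDiffOn_extChartAt_symm (1 : G)).contMDiffAt (extChartAt_target_mem_nhds 1)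
  have h2 : ContMDiffAt 𝓘(ℝ, EuclideanSpace ℝ (Fin m)) (𝓡 m) ∞ (extChartAt (𝓡 m) x).symm
      (extChartAt (𝓡 m) x x) :=
    (contMDiffOn_extChartAt_symm x).contMDiffAt (extChartAt_target_mem_nhds x)
  have h3 := (h1.comp (extChartAt (𝓡 k) (1 : G) 1, extChartAt (𝓡 m) x x)
    (contDiff_fst.contMDiff.contMDiffAt (n := ∞))).smul
    (h2.comp (extChartAt (𝓡 k) (1 : G) 1, extChartAt (𝓡 m) x x)
    (contDiff_snd.contMDiff.contMDiffAt (n := ∞)))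
  have h4 : ContMDiffAt (𝓡 m) 𝓘(ℝ, EuclideanSpace ℝ (Fin m)) ∞ (extChartAt (𝓡 m) x)
      ((extChartAt (𝓡 k) (1 : G)).symm (extChartAt (𝓡 k) (1 : G) 1) •
        (extChartAt (𝓡 m) x).symm (extChartAt (𝓡 m) x x)) := by
    rw [extChartAt_to_inv, extChartAt_to_inv, one_smul]
    exact contMDiffAt_extChartAt
  exact (h4.comp (extChartAt (𝓡 k) (1 : G) 1, extChartAt (𝓡 m) x x) h3).of_le two_le_smooth

omit [IsManifold (𝓡 m) ∞ M] [LieGroup (𝓡 k) ∞ G] in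
theorem mdifferentiableAt_smul_left (z : M) (g : G) :
    MDifferentiableAt (𝓡 k) (𝓡 m) (fun g : G => g • z) g :=
  (contMDiffAt_id.smul contMDiffAt_const (n := ∞)).mdifferentiableAt (by simp)

end GroupAction

theorem mdifferentiableAt_smul_right {m : ℕ} (k : ℕ) {M : Type*} [TopologicalSpace M]
    [ChartedSpace (EuclideanSpace ℝ (Fin m)) M] {G : Type*} [TopologicalSpace G]
    [ChartedSpace (EuclideanSpace ℝ (Fin k)) G] [Group G] [MulAction G M]
    [ContMDiffSMul (𝓡 k) (𝓡 m) ∞ G M] (g : G) (z : M) :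
    MDifferentiableAt (𝓡 m) (𝓡 m) (fun z : M => g • z) z :=
  ((contMDiffAt_const (I' := 𝓡 k) (c := g)).smul contMDiffAt_id (n := ∞)).mdifferentiableAt
    (by simp)

end SpincBochner

namespace SpincBochner

/-! ### Generating fields as partial derivatives of the action -/

section KillingField

variable {m k : ℕ} {M : Type*} [TopologicalSpace M] [ChartedSpace (EuclideanSpace ℝ (Fin m)) M]
  [IsManifold (𝓡 m) ∞ M]
  {G : Type*} [TopologicalSpace G] [ChartedSpace (EuclideanSpace ℝ (Fin k)) G] [Group G]
  [LieGroup (𝓡 k) ∞ G] [MulAction G M] [ContMDiffSMul (𝓡 k) (𝓡 m) ∞ G M]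

theorem eventually_differentiableAt_actionChart (x : M) :
    ∀ᶠ q in 𝓝 (extChartAt (𝓡 k) (1 : G) 1, extChartAt (𝓡 m) x x),
      DifferentiableAt ℝ (actionChart G x) q := by
  filter_upwards [(contDiffAt_actionChart (G := G) x).eventually (by simp)] with q hq
  exact hq.differentiableAt (by simp)

/-- The chain rule for `g ↦ g • z` read in the chart at `x`. It holds for all `z` near `x`, so the
field can be differentiated through the chart expression of the action. -/
theorem eventually_fderiv_actionChart_left (x : M) (ξ : EuclideanSpace ℝ (Fin k)) :
    ∀ᶠ z in 𝓝 x,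
      (trivializationAt (EuclideanSpace ℝ (Fin m)) (TangentSpace (𝓡 m)) x).continuousLinearMapAt ℝ z
        (killingField (G := G) ξ z)
      = fderiv ℝ (actionChart G x) (extChartAt (𝓡 k) (1 : G) 1, extChartAt (𝓡 m) x z) (ξ, 0) := by
  have hc : Filter.Tendsto (fun z => (extChartAt (𝓡 k) (1 : G) 1, extChartAt (𝓡 m) x z)) (𝓝 x)
      (𝓝 (extChartAt (𝓡 k) (1 : G) 1, extChartAt (𝓡 m) x x)) :=
    tendsto_const_nhds.prodMk_nhds (continuousAt_extChartAt x)
  filter_upwards [hc.eventually (eventually_differentiableAt_actionChart x),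
    extChartAt_source_mem_nhds (I := 𝓡 m) x] with z hz hzx
  have hzc : z ∈ (chartAt (EuclideanSpace ℝ (Fin m)) x).source := by rwa [← extChartAt_source (𝓡 m)]
  have h1 : MDifferentiableAt (𝓡 m) 𝓘(ℝ, EuclideanSpace ℝ (Fin m)) (extChartAt (𝓡 m) x)
      ((1 : G) • z) := by
    rw [one_smul]
    exact mdifferentiableAt_extChartAt hzc
  have h2 := mdifferentiableAt_smul_left (k := k) (m := m) z (1 : G)
  have h3 : mvfderiv (𝓡 m) (extChartAt (𝓡 m) x) z (killingField (G := G) ξ z)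
      = mvfderiv (𝓡 k) (fun g : G => extChartAt (𝓡 m) x (g • z)) 1 ξ := by
    have := mfderiv_comp_of_eq (x := (1 : G)) (y := (1 : G) • z) h1 h2 rfl
    have h4 := congrArg (fun f => f ξ) this
    rw [one_smul] at h4
    exact h4.symm
  rw [continuousLinearMapAt_eq_mvfderiv hzc]
  refine h3.trans ((mvfderiv_eq_fderiv_chart (g := fun g : G => extChartAt (𝓡 m) x (g • z))
    (h1.comp (1 : G) h2) (h := fun s => actionChart G x (s, extChartAt (𝓡 m) x z)) ?_ ξ).trans ?_)
  · filter_upwards with s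
    simp only [actionChart, (extChartAt (𝓡 m) x).left_inv hzx]
  · have h5 := hz.hasFDerivAt.comp (extChartAt (𝓡 k) (1 : G) 1)
      ((hasFDerivAt_id (𝕜 := ℝ) (extChartAt (𝓡 k) (1 : G) 1)).prodMk
        (hasFDerivAt_const (extChartAt (𝓡 m) x z) _))
    have h6 := h5.fderiv
    refine (congrArg (fun f => f ξ) h6).trans ?_
    simp

theorem differentiableAt_fderiv_actionChart (x : M) :
    DifferentiableAt ℝ (fderiv ℝ (actionChart (k := k) (m := m) G x))
      (extChartAt (𝓡 k) (1 : G) 1, extChartAt (𝓡 m) x x) :=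
  ((contDiffAt_actionChart (m := m) x).fderiv_right (m := 1) (by norm_num)).differentiableAt
    (by simp)

theorem mdiffFieldAt_killingField (ξ : EuclideanSpace ℝ (Fin k)) (x : M) :
    MDiffFieldAt (killingField (m := m) (G := G) ξ) x := by
  rw [mdifferentiableAt_coord_iff]
  refine MDifferentiableAt.congr_of_eventuallyEq ?_
    (eventually_fderiv_actionChart_left (m := m) (G := G) x ξ)
  have h1 : DifferentiableAt ℝ (fun u => fderiv ℝ (actionChart G x)
      (extChartAt (𝓡 k) (1 : G) 1, u) (ξ, 0)) (extChartAt (𝓡 m) x x) := by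
    have h2 : DifferentiableAt ℝ (fun u : EuclideanSpace ℝ (Fin m) =>
      (extChartAt (𝓡 k) (1 : G) 1, u)) (extChartAt (𝓡 m) x x) := by fun_prop
    exact (DifferentiableAt.comp (extChartAt (𝓡 m) x x)
      (differentiableAt_fderiv_actionChart (m := m) x) h2).clm_apply (differentiableAt_const _)
  exact h1.mdifferentiableAt.comp x (mdifferentiableAt_extChartAt (mem_chart_source _ x))

/-- At a zero, `∇` is the derivative of the coordinates, and these are a partial derivative of the
action along `G`. Exchanging the two differentiations exhibits `∇V_ξ` as the infinitesimal isotropy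
representation, the derivative along `ξ` of the differentials of the group elements. -/
theorem cov_killingField_eq_fderiv_fderiv
    (cov : CovariantDerivative (𝓡 m) (EuclideanSpace ℝ (Fin m))
      (fun x : M => TangentSpace (𝓡 m) x))
    {ξ : EuclideanSpace ℝ (Fin k)} {x : M} (h0 : killingField (m := m) (G := G) ξ x = 0)
    (v : EuclideanSpace ℝ (Fin m)) :
    cov (killingField (G := G) ξ) x v
      = fderiv ℝ (fderiv ℝ (actionChart (k := k) (m := m) G x))
        (extChartAt (𝓡 k) (1 : G) 1, extChartAt (𝓡 m) x x) (ξ, 0) (0, v) := by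
  have hd := mdiffFieldAt_killingField (m := m) (G := G) ξ x
  refine (cov_eq_mvfderiv_coord cov hd h0 v).trans ?_
  rw [mdifferentiableAt_coord_iff] at hd
  have hsymm : Filter.Tendsto (extChartAt (𝓡 m) x).symm (𝓝 (extChartAt (𝓡 m) x x)) (𝓝 x) := by
    have := continuousAt_extChartAt_symm (I := 𝓡 m) x
    rwa [ContinuousAt, extChartAt_to_inv] at this
  refine (mvfderiv_eq_fderiv_chart hd (h := fun u => fderiv ℝ (actionChart G x)
      (extChartAt (𝓡 k) (1 : G) 1, u) (ξ, 0)) ?_ v).trans ?_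
  swap
  · have h5 := ((differentiableAt_fderiv_actionChart (G := G) x).hasFDerivAt.comp
      (extChartAt (𝓡 m) x x)
      ((hasFDerivAt_const (extChartAt (𝓡 k) (1 : G) 1) _).prodMk
        (hasFDerivAt_id (𝕜 := ℝ) (extChartAt (𝓡 m) x x)))).clm_apply
      (hasFDerivAt_const ((ξ, 0) : EuclideanSpace ℝ (Fin k) × EuclideanSpace ℝ (Fin m)) _)
    have h6 := congrArg (fun f => f v) h5.fderiv
    refine Eq.trans h6 ?_
    have h7 := (contDiffAt_actionChart (k := k) (m := m) (G := G) x).isSymmSndFDerivAt (by simp)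
    simpa using h7 (0, v) (ξ, 0)
  · filter_upwards [hsymm.eventually (eventually_fderiv_actionChart_left (m := m) (G := G) x ξ),
      extChartAt_target_mem_nhds (I := 𝓡 m) x] with u hu hut
    rw [hu, (extChartAt (𝓡 m) x).right_inv hut]

end KillingField

end SpincBochner

namespace SpincBochner

/-! ### The linearization of a generating field commutes with `J` -/

section KillingField

variable {m k : ℕ} {M : Type*} [TopologicalSpace M] [ChartedSpace (EuclideanSpace ℝ (Fin m)) M]
  [IsManifold (𝓡 m) ∞ M]
  {G : Type*} [TopologicalSpace G] [ChartedSpace (EuclideanSpace ℝ (Fin k)) G] [Group G]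
  [LieGroup (𝓡 k) ∞ G] [MulAction G M] [ContMDiffSMul (𝓡 k) (𝓡 m) ∞ G M]

/-- The endomorphism `A z` of the tangent space at `z` in the coordinates near `x`. -/
noncomputable def coordEnd (A : Π z : M, TangentSpace (𝓡 m) z →L[ℝ] TangentSpace (𝓡 m) z)
    (x z : M) :
    EuclideanSpace ℝ (Fin m) →L[ℝ] EuclideanSpace ℝ (Fin m) :=
  ContinuousLinearMap.inCoordinates (EuclideanSpace ℝ (Fin m)) (TangentSpace (𝓡 m))
    (EuclideanSpace ℝ (Fin m)) (TangentSpace (𝓡 m)) x z x z (A z)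

theorem coordEnd_apply (A : Π z : M, TangentSpace (𝓡 m) z →L[ℝ] TangentSpace (𝓡 m) z) {x z : M}
    (hz : z ∈ (chartAt (EuclideanSpace ℝ (Fin m)) x).source) (v : TangentSpace (𝓡 m) z) :
    coordEnd A x z
      ((trivializationAt (EuclideanSpace ℝ (Fin m)) (TangentSpace (𝓡 m)) x).continuousLinearMapAt ℝ
        z v)
      = (trivializationAt (EuclideanSpace ℝ (Fin m)) (TangentSpace (𝓡 m)) x).continuousLinearMapAt ℝ
        z (A z v) := by
  have hz' : z ∈ (trivializationAt (EuclideanSpace ℝ (Fin m)) (TangentSpace (𝓡 m)) x).baseSet := hz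
  simp only [coordEnd, ContinuousLinearMap.inCoordinates, ContinuousLinearMap.comp_apply]
  rw [Trivialization.symmL_continuousLinearMapAt _ hz']

/-- The counterpart of `eventually_fderiv_actionChart_left` in the other variable: the partial
derivative along `M` is the differential of a group element. -/
theorem eventually_fderiv_actionChart_right (x : M) :
    ∀ᶠ s in 𝓝 (extChartAt (𝓡 k) (1 : G) 1),
      (extChartAt (𝓡 k) (1 : G)).symm s • x ∈ (chartAt (EuclideanSpace ℝ (Fin m)) x).source ∧
      ∀ v : EuclideanSpace ℝ (Fin m),
        (trivializationAt (EuclideanSpace ℝ (Fin m)) (TangentSpace (𝓡 m)) x).continuousLinearMapAt ℝ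
          ((extChartAt (𝓡 k) (1 : G)).symm s • x)
          (mfderiv (𝓡 m) (𝓡 m) (fun z : M => (extChartAt (𝓡 k) (1 : G)).symm s • z) x v)
        = fderiv ℝ (actionChart G x) (s, extChartAt (𝓡 m) x x) (0, v) := by
  have hc : Filter.Tendsto (fun s => (s, extChartAt (𝓡 m) x x)) (𝓝 (extChartAt (𝓡 k) (1 : G) 1))
      (𝓝 (extChartAt (𝓡 k) (1 : G) 1, extChartAt (𝓡 m) x x)) :=
    Filter.tendsto_id.prodMk_nhds tendsto_const_nhds
  have hg : Filter.Tendsto (fun s => (extChartAt (𝓡 k) (1 : G)).symm s • x)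
      (𝓝 (extChartAt (𝓡 k) (1 : G) 1)) (𝓝 x) := by
    have h1 := (mdifferentiableAt_smul_left (k := k) (m := m) x (1 : G)).continuousAt
    have h2 := continuousAt_extChartAt_symm (I := 𝓡 k) (1 : G)
    rw [ContinuousAt, extChartAt_to_inv] at h2
    have h3 := h1.tendsto.comp h2
    rwa [one_smul] at h3
  filter_upwards [hc.eventually (eventually_differentiableAt_actionChart x),
    hg.eventually ((chartAt (EuclideanSpace ℝ (Fin m)) x).open_source.mem_nhds
      (mem_chart_source _ x))] with s hs hsx
  refine ⟨hsx, fun v => ?_⟩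
  rw [continuousLinearMapAt_eq_mvfderiv hsx]
  set g := (extChartAt (𝓡 k) (1 : G)).symm s with hgdef
  have h1 : MDifferentiableAt (𝓡 m) 𝓘(ℝ, EuclideanSpace ℝ (Fin m)) (extChartAt (𝓡 m) x) (g • x) :=
    mdifferentiableAt_extChartAt hsx
  have h2 := mdifferentiableAt_smul_right (m := m) k g x
  have h3 : mvfderiv (𝓡 m) (extChartAt (𝓡 m) x) (g • x)
        (mfderiv (𝓡 m) (𝓡 m) (fun z : M => g • z) x v)
      = mvfderiv (𝓡 m) (fun z : M => extChartAt (𝓡 m) x (g • z)) x v :=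
    (congrArg (fun f => f v) (mfderiv_comp_of_eq (x := x) (y := g • x) h1 h2 rfl)).symm
  refine h3.trans ((mvfderiv_eq_fderiv_chart (g := fun z : M => extChartAt (𝓡 m) x (g • z))
    (h1.comp x h2) (h := fun u => actionChart G x (s, u)) ?_ v).trans ?_)
  · filter_upwards with u
    rfl
  · have h5 := hs.hasFDerivAt.comp (extChartAt (𝓡 m) x x)
      ((hasFDerivAt_const s (extChartAt (𝓡 m) x x)).prodMk
        (hasFDerivAt_id (𝕜 := ℝ) (extChartAt (𝓡 m) x x)))
    refine (congrArg (fun f => f v) h5.fderiv).trans ?_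
    simp

/-- At a zero of the vector field generated by `ξ`, its covariant derivative commutes with every
endomorphism of the tangent bundle that the action preserves. -/
theorem cov_killingField_comm
    (cov : CovariantDerivative (𝓡 m) (EuclideanSpace ℝ (Fin m))
      (fun x : M => TangentSpace (𝓡 m) x)) {x : M}
    {J : Π x : M, TangentSpace (𝓡 m) x →L[ℝ] TangentSpace (𝓡 m) x}
    (hJ : MDifferentiableAt (𝓡 m)
      ((𝓡 m).prod 𝓘(ℝ, EuclideanSpace ℝ (Fin m) →L[ℝ] EuclideanSpace ℝ (Fin m)))
      (fun x => TotalSpace.mk' (EuclideanSpace ℝ (Fin m) →L[ℝ] EuclideanSpace ℝ (Fin m))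
        (E := fun x : M => TangentSpace (𝓡 m) x →L[ℝ] TangentSpace (𝓡 m) x) x (J x)) x)
    (hJG : ∀ (g : G) (x : M) (v : TangentSpace (𝓡 m) x),
      mfderiv (𝓡 m) (𝓡 m) (fun y : M => g • y) x (J x v)
        = J (g • x) (mfderiv (𝓡 m) (𝓡 m) (fun y : M => g • y) x v))
    {ξ : EuclideanSpace ℝ (Fin k)} (h0 : killingField (m := m) (G := G) ξ x = 0)
    (v : TangentSpace (𝓡 m) x) :
    cov (killingField (G := G) ξ) x (J x v) = J x (cov (killingField (G := G) ξ) x v) := by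
  have hJd : MDifferentiableAt (𝓡 m) 𝓘(ℝ, EuclideanSpace ℝ (Fin m) →L[ℝ] EuclideanSpace ℝ (Fin m))
      (coordEnd J x) x := ((mdifferentiableAt_hom_bundle _).1 hJ).2
  have hJx (w : EuclideanSpace ℝ (Fin m)) : coordEnd J x x w = J x w := by
    have h1 := coordEnd_apply J (mem_chart_source _ x) (w : TangentSpace (𝓡 m) x)
    exact (congrArg (coordEnd J x x) (continuousLinearMapAt_self x w)).symm.trans
      (h1.trans (continuousLinearMapAt_self x _))
  have hJg : MDifferentiableAt (𝓡 k) 𝓘(ℝ, EuclideanSpace ℝ (Fin m) →L[ℝ] EuclideanSpace ℝ (Fin m))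
      (fun g : G => coordEnd J x (g • x)) 1 :=
    hJd.comp_of_eq _ (mdifferentiableAt_smul_left (k := k) (m := m) x (1 : G)) (one_smul G x)
  -- The derivative of `g • x` along `ξ` is `V_ξ(x) = 0`, so `J` at `g • x` is stationary to first
  -- order.
  have hJg0 : mvfderiv (𝓡 k) (fun g : G => coordEnd J x (g • x)) 1 ξ = 0 := by
    have h1 := mfderiv_comp_of_eq (x := (1 : G)) (y := x) hJd
      (mdifferentiableAt_smul_left (k := k) (m := m) x (1 : G)) (one_smul G x)
    have h2 := congrArg (fun f => f ξ) h1
    exact h2.trans ((congrArg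
      (mfderiv (𝓡 m) 𝓘(ℝ, EuclideanSpace ℝ (Fin m) →L[ℝ] EuclideanSpace ℝ (Fin m))
        (coordEnd J x) ((1 : G) • x)) h0).trans
      (ContinuousLinearMap.map_zero _))
  set s₀ := extChartAt (𝓡 k) (1 : G) 1 with hs₀
  set u₀ := extChartAt (𝓡 m) x x with hu₀
  let K : EuclideanSpace ℝ (Fin k) → EuclideanSpace ℝ (Fin m) →L[ℝ] EuclideanSpace ℝ (Fin m) :=
    fun s => coordEnd J x ((extChartAt (𝓡 k) (1 : G)).symm s • x)
  have hK : DifferentiableAt ℝ K s₀ := by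
    have h1 : MDifferentiableAt 𝓘(ℝ, EuclideanSpace ℝ (Fin k)) (𝓡 k)
        (extChartAt (𝓡 k) (1 : G)).symm s₀ :=
      ((contMDiffOn_extChartAt_symm (n := ∞) (1 : G)).contMDiffAt
        (extChartAt_target_mem_nhds 1)).mdifferentiableAt (by simp)
    exact (hJg.comp_of_eq _ h1 (extChartAt_to_inv 1)).differentiableAt
  have hK0 : fderiv ℝ K s₀ ξ = 0 := by
    rw [← hJg0]
    exact (mvfderiv_eq_fderiv_chart hJg (h := K) (Filter.Eventually.of_forall fun s => rfl) ξ).symm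
  have hKs : K s₀ = coordEnd J x x := by
    simp only [K, hs₀, extChartAt_to_inv, one_smul]
  have hF := differentiableAt_fderiv_actionChart (k := k) (m := m) (G := G) x
  have hP (w : EuclideanSpace ℝ (Fin m)) : HasFDerivAt
      (fun s => fderiv ℝ (actionChart G x) (s, u₀) (0, w)) _ s₀ :=
    (hF.hasFDerivAt.comp s₀ ((hasFDerivAt_id (𝕜 := ℝ) s₀).prodMk
      (hasFDerivAt_const u₀ s₀))).clm_apply (hasFDerivAt_const ((0, w) :
        EuclideanSpace ℝ (Fin k) × EuclideanSpace ℝ (Fin m)) s₀)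
  -- Invariance of `J` in the charts. It is differentiated along `ξ` at the identity, where the
  -- derivative of `K` vanishes.
  have hrel : (fun s => fderiv ℝ (actionChart G x) (s, u₀) (0, J x v))
      =ᶠ[𝓝 s₀] fun s => K s (fderiv ℝ (actionChart G x) (s, u₀) (0, v)) := by
    filter_upwards [eventually_fderiv_actionChart_right (m := m) (k := k) (G := G) x] with s hs
    exact ((hs.2 _).symm.trans ((congrArg _ (hJG _ x v)).trans
      (coordEnd_apply J hs.1 _).symm)).trans (congrArg (K s) (hs.2 v))
  have hD (w : EuclideanSpace ℝ (Fin m)) :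
      fderiv ℝ (fun s => fderiv ℝ (actionChart G x) (s, u₀) (0, w)) s₀ ξ
        = fderiv ℝ (fderiv ℝ (actionChart G x)) (s₀, u₀) (ξ, 0) (0, w) := by
    rw [(hP w).fderiv]
    simp [hs₀, hu₀]
  have h1 : fderiv ℝ (fun s => fderiv ℝ (actionChart G x) (s, u₀) (0, J x v)) s₀ ξ
      = K s₀ (fderiv ℝ (fun s => fderiv ℝ (actionChart G x) (s, u₀) (0, v)) s₀ ξ) := by
    have h2 := hK.hasFDerivAt.clm_apply (hP v).differentiableAt.hasFDerivAt
    refine (congrArg (fun f => f ξ) (hrel.fderiv_eq.trans h2.fderiv)).trans ?_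
    simp [hK0]
  exact (cov_killingField_eq_fderiv_fderiv cov h0 _).trans ((hD _).symm.trans (h1.trans
    ((congrArg (K s₀) ((hD v).trans (cov_killingField_eq_fderiv_fderiv cov h0 v).symm)).trans
      ((congrArg (fun f : EuclideanSpace ℝ (Fin m) →L[ℝ] EuclideanSpace ℝ (Fin m) =>
          f (cov (killingField (G := G) ξ) x v)) hKs).trans (hJx _)))))

end KillingField

end SpincBochner

namespace SpincBochner

/-! ### The moment map of an Abelian action -/

section MomentMap

variable {m k : ℕ} {M : Type*} [TopologicalSpace M] [ChartedSpace (EuclideanSpace ℝ (Fin m)) M]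

theorem Ad_of_commGroup {G : Type*} [TopologicalSpace G] [ChartedSpace (EuclideanSpace ℝ (Fin k)) G]
    [CommGroup G] (g : G) (ξ : GroupLieAlgebra (𝓡 k) G) : Ad g ξ = ξ := by
  have h : (fun h : G => g * h * g⁻¹) = id := by
    funext h
    rw [mul_comm g h, mul_inv_cancel_right, id]
  rw [Ad, h, mfderiv_id]
  rfl

theorem killingField_sum_smul {G : Type*} [TopologicalSpace G]
    [ChartedSpace (EuclideanSpace ℝ (Fin k)) G] [Group G] [MulAction G M]
    {κ : Type*} [Fintype κ] (c : κ → ℝ) (ξ : κ → GroupLieAlgebra (𝓡 k) G) (x : M) :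
    killingField (m := m) (∑ i, c i • ξ i) x = ∑ i, c i • killingField (ξ i) x := by
  have h := map_sum (mfderiv (𝓡 k) (𝓡 m) (fun g : G => g • x) 1) (fun i => c i • ξ i) Finset.univ
  refine h.trans (Finset.sum_congr rfl fun i _ => ?_)
  exact ContinuousLinearMap.map_smul _ _ _

section Connection

variable [IsManifold (𝓡 m) ∞ M]

theorem cov_sum_smul (cov : CovariantDerivative (𝓡 m) (EuclideanSpace ℝ (Fin m))
      (fun x : M => TangentSpace (𝓡 m) x)) {κ : Type*} (s : Finset κ) {x : M} {f : κ → M → ℝ}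
    {σ : κ → Π z : M, TangentSpace (𝓡 m) z}
    (hf : ∀ i, MDifferentiableAt (𝓡 m) 𝓘(ℝ, ℝ) (f i) x) (hσ : ∀ i, MDiffFieldAt (σ i) x)
    (v : TangentSpace (𝓡 m) x) :
    cov (fun z => ∑ i ∈ s, f i z • σ i z) x v
      = ∑ i ∈ s, (f i x • cov (σ i) x v + mvfderiv (𝓡 m) (f i) x v • σ i x) := by
  have hd (i : κ) : MDiffFieldAt (fun z => f i z • σ i z) x := (hf i).smul_section (hσ i)
  classical
  induction s using Finset.induction_on with
  | empty =>
    have h := cov.isCovariantDerivativeOnUniv.zero (x := x) (Set.mem_univ x)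
    simp only [Finset.sum_empty]
    exact congrArg (fun T => T v) h
  | insert i s hi ih =>
    have h1 := cov.isCovariantDerivativeOnUniv.add (hd i)
      (MDifferentiableAt.sum_section fun j (_ : j ∈ s) => hd j) (Set.mem_univ x)
    have h2 := cov.isCovariantDerivativeOnUniv.leibniz (hσ i) (hf i) (Set.mem_univ x)
    have h3 : (fun z => ∑ j ∈ insert i s, f j z • σ j z)
        = (fun z => f i z • σ i z) + fun z => ∑ j ∈ s, f j z • σ j z := by
      funext z
      simp only [Finset.sum_insert hi, Pi.add_apply]
    rw [h3, Finset.sum_insert hi, ← ih]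
    refine (congrArg (fun T => T v) h1).trans ?_
    have h4 := congrArg (fun T => T v) h2
    exact congrArg (· + cov (fun z => ∑ j ∈ s, f j z • σ j z) x v) h4

end Connection

section Action

variable {G : Type*} [TopologicalSpace G] [ChartedSpace (EuclideanSpace ℝ (Fin k)) G] [CommGroup G]
  [MulAction G M]
  {Ω : Π x : M, TangentSpace (𝓡 m) x →L[ℝ] TangentSpace (𝓡 m) x →L[ℝ] ℝ}
  {J : Π x : M, TangentSpace (𝓡 m) x →L[ℝ] TangentSpace (𝓡 m) x}
  {μ : M → Module.Dual ℝ (GroupLieAlgebra (𝓡 k) G)}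

/-- The orbits of an Abelian group are isotropic. -/
theorem IsHamiltonianAction.bilin_killingField_killingField
    [ContMDiffSMul (𝓡 k) (𝓡 m) ∞ G M] (hμ : IsHamiltonianAction Ω J μ)
    (ξ η : GroupLieAlgebra (𝓡 k) G) (z : M) :
    Ω z (killingField ξ z) (killingField η z) = 0 := by
  rw [hμ.moment ξ z]
  have h1 : MDifferentiableAt (𝓡 m) 𝓘(ℝ, ℝ) (fun x => μ x ξ) ((1 : G) • z) :=
    (hμ.contMDiff_moment ξ).mdifferentiable (by simp) _
  have h2 := congrArg (fun T => T η) (mfderiv_comp_of_eq (x := (1 : G)) (y := (1 : G) • z) h1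
    (mdifferentiableAt_smul_left (k := k) (m := m) z (1 : G)) rfl)
  rw [one_smul] at h2
  refine h2.symm.trans ?_
  -- The adjoint action is trivial, so equivariance makes the moment map constant on orbits.
  have h3 : (fun x => μ x ξ) ∘ (fun g : G => g • z) = fun _ => μ z ξ := by
    funext g
    have h := hμ.equivariant g z ξ
    rwa [Ad_of_commGroup] at h
  rw [h3, mfderiv_const]
  rfl

theorem IsHamiltonianAction.contMDiff_momentNormSq (hμ : IsHamiltonianAction Ω J μ)
    (b : Module.Basis (Fin k) ℝ (GroupLieAlgebra (𝓡 k) G)) :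
    ContMDiff (𝓡 m) 𝓘(ℝ, ℝ) ∞ (momentNormSq b μ) := by
  have h (i : Fin k) := (hμ.contMDiff_moment (b i)).pow 2
  exact contMDiff_finsetSum fun i _ => h i

theorem IsHamiltonianAction.mvfderiv_momentNormSq (hμ : IsHamiltonianAction Ω J μ)
    (b : Module.Basis (Fin k) ℝ (GroupLieAlgebra (𝓡 k) G)) (z : M) (v : TangentSpace (𝓡 m) z) :
    mvfderiv (𝓡 m) (momentNormSq b μ) z v
      = Ω z (∑ i, (2 * μ z (b i)) • killingField (b i) z) v := by
  have h (s : Finset (Fin k)) :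
      MDifferentiableAt (𝓡 m) 𝓘(ℝ, ℝ) (fun z => ∑ i ∈ s, μ z (b i) ^ 2) z ∧
      mvfderiv (𝓡 m) (fun z => ∑ i ∈ s, μ z (b i) ^ 2) z v
        = ∑ i ∈ s, 2 * μ z (b i) * Ω z (killingField (b i) z) v := by
    induction s using Finset.induction_on with
    | empty =>
      simp only [Finset.sum_empty]
      exact ⟨mdifferentiableAt_const, by rw [mvfderiv_const]; rfl⟩
    | insert i s hi ih =>
      have h1 : MDifferentiableAt (𝓡 m) 𝓘(ℝ, ℝ) (fun x => μ x (b i)) z :=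
        (hμ.contMDiff_moment (b i)).mdifferentiable (by simp) _
      have h2 : (fun z => ∑ j ∈ insert i s, μ z (b j) ^ 2)
          = (fun x => μ x (b i)) * (fun x => μ x (b i)) + fun z => ∑ j ∈ s, μ z (b j) ^ 2 := by
        funext z
        simp [Finset.sum_insert hi, sq]
      rw [h2]
      refine ⟨(h1.mul h1).add ih.1, ?_⟩
      rw [mvfderiv_add (h1.mul h1) ih.1, mvfderiv_mul h1 h1, Finset.sum_insert hi, ← ih.2,
        hμ.moment (b i) z]
      simp only [add_apply, smul_apply, smul_eq_mul]
      ring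
  refine (h Finset.univ).2.trans ?_
  simp

end Action

end MomentMap

end SpincBochner

namespace SpincBochner

/-! ### The linearization at a critical point of the norm square -/

section Critical

variable {m k : ℕ} {M : Type*} [TopologicalSpace M] [ChartedSpace (EuclideanSpace ℝ (Fin m)) M]
  [IsManifold (𝓡 m) ∞ M] [RiemannianBundle (fun x : M => TangentSpace (𝓡 m) x)]
  {Ω : Π x : M, TangentSpace (𝓡 m) x →L[ℝ] TangentSpace (𝓡 m) x →L[ℝ] ℝ}
  {J : Π x : M, TangentSpace (𝓡 m) x →L[ℝ] TangentSpace (𝓡 m) x}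

omit [RiemannianBundle (fun x : M => TangentSpace (𝓡 m) x)] in
theorem IsSymplecticForm.neg (hΩ : IsSymplecticForm Ω) (x : M) (u v : TangentSpace (𝓡 m) x) :
    Ω x u v = -Ω x v u := by
  have h := hΩ.alternating x (u + v)
  simp only [map_add, add_apply, hΩ.alternating, zero_add, add_zero] at h
  linarith

omit [RiemannianBundle (fun x : M => TangentSpace (𝓡 m) x)] in
theorem IsSymplecticForm.mdifferentiableAt (hΩ : IsSymplecticForm Ω) (x : M) :
    MDifferentiableAt (𝓡 m)
      ((𝓡 m).prod 𝓘(ℝ, EuclideanSpace ℝ (Fin m) →L[ℝ] EuclideanSpace ℝ (Fin m) →L[ℝ] ℝ))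
      (fun x => TotalSpace.mk' (EuclideanSpace ℝ (Fin m) →L[ℝ] EuclideanSpace ℝ (Fin m) →L[ℝ] ℝ)
        (E := fun x : M => TangentSpace (𝓡 m) x →L[ℝ] TangentSpace (𝓡 m) x →L[ℝ] ℝ) x (Ω x)) x :=
  hΩ.contMDiff.mdifferentiable (by simp) x

theorem IsCompatibleAlmostComplex.inner_apply_left (hJ : IsCompatibleAlmostComplex Ω J)
    (hΩ : IsSymplecticForm Ω) (x : M) (u v : TangentSpace (𝓡 m) x) :
    inner ℝ (J x u) v = Ω x u v := by
  rw [real_inner_comm, hJ.metric_eq, hJ.sq, map_neg, ← hΩ.neg]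

omit [IsManifold (𝓡 m) ∞ M] in
/-- In the coordinates of a diagonal expansion the Hessian is diagonal. -/
theorem HasDiagonalExpansion.fderiv_fderiv {f : M → ℝ} {x : M}
    {e : OrthonormalBasis (Fin m) ℝ (TangentSpace (𝓡 m) x)} {y : M → EuclideanSpace ℝ (Fin m)}
    {a : Fin m → ℝ} (hy : HasDiagonalExpansion f x e y a)
    (hf : ContMDiff (𝓡 m) 𝓘(ℝ, ℝ) ∞ f) (i j : Fin m) :
    fderiv ℝ (fderiv ℝ (f ∘ (extChartAt (𝓡 m) x).symm)) (extChartAt (𝓡 m) x x) (e i) (e j)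
      = if i = j then 2 * a i else 0 := by
  set u₀ := extChartAt (𝓡 m) x x with hu₀
  have hfc := contDiffAt_chart ((hf x).of_le two_le_smooth)
  have hyc := contDiffAt_chart (hy.contMDiffAt.of_le two_le_smooth)
  have hsymm : Filter.Tendsto (extChartAt (𝓡 m) x).symm (𝓝 u₀) (𝓝 x) := by
    have := continuousAt_extChartAt_symm (I := 𝓡 m) x
    rwa [ContinuousAt, extChartAt_to_inv] at this
  have hyu : (y ∘ (extChartAt (𝓡 m) x).symm) u₀ = 0 := by
    rw [Function.comp_apply, hu₀, extChartAt_to_inv, hy.center]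
  have hexp := hy.expansion.comp_tendsto hsymm
  have h1 := fderiv_fderiv_of_expansion hfc hyc hyu a
    (hexp.congr (fun u => by simp only [Function.comp, extChartAt_to_inv]) fun u => rfl)
    (e i) (e j)
  have h2 (l : Fin m) : fderiv ℝ (y ∘ (extChartAt (𝓡 m) x).symm) u₀ (e l)
      = EuclideanSpace.single l 1 := by
    refine Eq.trans ?_ (hy.frame l)
    exact (mvfderiv_eq_fderiv_chart (hy.contMDiffAt.mdifferentiableAt (by simp))
      (Filter.Eventually.of_forall fun _ => rfl) (e l)).symm
  have h3 (l n : Fin m) : fderiv ℝ (y ∘ (extChartAt (𝓡 m) x).symm) u₀ (e l) n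
      = if n = l then 1 else 0 :=
    (congrArg (fun w : EuclideanSpace ℝ (Fin m) => w n) (h2 l)).trans (PiLp.single_apply ..)
  refine h1.trans ((Finset.sum_congr rfl fun n _ =>
    congrArg₂ (fun p q => 2 * a n * (p * q)) (h3 i n) (h3 j n)).trans ?_)
  rcases eq_or_ne i j with rfl | hij
  · simp
  · simp [hij, hij.symm]

variable {G : Type*} [TopologicalSpace G] [ChartedSpace (EuclideanSpace ℝ (Fin k)) G] [CommGroup G]
  [LieGroup (𝓡 k) ∞ G] [MulAction G M] [ContMDiffSMul (𝓡 k) (𝓡 m) ∞ G M]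
  {μ : M → Module.Dual ℝ (GroupLieAlgebra (𝓡 k) G)}

/-- This is where the geometry is reduced to linear algebra. Each component follows from
differentiating an identity between fields at a point where `X^H` or `V_ξ` vanishes. -/
theorem isMomentLinearization (hΩ : IsSymplecticForm Ω) (hJ : IsCompatibleAlmostComplex Ω J)
    (cov : CovariantDerivative (𝓡 m) (EuclideanSpace ℝ (Fin m))
      (fun x : M => TangentSpace (𝓡 m) x)) (hμ : IsHamiltonianAction Ω J μ)
    (b : Module.Basis (Fin k) ℝ (GroupLieAlgebra (𝓡 k) G))
    {XH : Π x : M, TangentSpace (𝓡 m) x}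
    (hXH : IsHamiltonianVectorField Ω (momentNormSq b μ) XH)
    {x : M} (hx : mvfderiv (𝓡 m) (momentNormSq b μ) x = 0)
    {e : OrthonormalBasis (Fin m) ℝ (TangentSpace (𝓡 m) x)}
    {y : M → EuclideanSpace ℝ (Fin m)} {a : Fin m → ℝ}
    (hy : HasDiagonalExpansion (momentNormSq b μ) x e y a) :
    IsMomentLinearization (J x).toLinearMap (cov XH x).toLinearMap
        (cov (killingField (∑ i, μ x (b i) • b i)) x).toLinearMap
        (fun i => killingField (b i) x) e a ∧
      (cov (fun z => J z (XH z)) x).toLinearMap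
        = (J x).toLinearMap ∘ₗ (cov XH x).toLinearMap := by
  have hJd : MDifferentiableAt (𝓡 m)
      ((𝓡 m).prod 𝓘(ℝ, EuclideanSpace ℝ (Fin m) →L[ℝ] EuclideanSpace ℝ (Fin m)))
      (fun x => TotalSpace.mk' (EuclideanSpace ℝ (Fin m) →L[ℝ] EuclideanSpace ℝ (Fin m))
        (E := fun x : M => TangentSpace (𝓡 m) x →L[ℝ] TangentSpace (𝓡 m) x) x (J x)) x :=
    hJ.contMDiff.mdifferentiable (by simp) x
  have hΩd := hΩ.mdifferentiableAt x
  have hin := hJ.inner_apply_left hΩ x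
  have hH := hμ.contMDiff_momentNormSq b
  set ξ := ∑ i, μ x (b i) • b i with hξ
  have hXHeq : XH = fun z => ∑ i, (2 * μ z (b i)) • killingField (b i) z := by
    funext z
    refine sub_eq_zero.1 (hΩ.nondegenerate z _ fun v => ?_)
    rw [map_sub, sub_apply, hXH z v, hμ.mvfderiv_momentNormSq b z v, sub_self]
  have hXH0 : XH x = 0 := by
    refine hΩ.nondegenerate x _ fun v => ?_
    rw [hXH x v, hx]
    rfl
  have hVd (η : GroupLieAlgebra (𝓡 k) G) : MDiffFieldAt (killingField (m := m) η) x :=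
    mdiffFieldAt_killingField η x
  have hVξ : killingField (m := m) ξ = fun z : M => ∑ i, μ x (b i) • killingField (b i) z :=
    funext fun z => killingField_sum_smul (m := m) _ _ z
  -- The coefficients of `ξ` are frozen at `x`, so `2 V_ξ` and `X^H` agree at `x` but in general not
  -- nearby.
  have hV0 : killingField (m := m) ξ x = 0 := by
    have h : (2 : ℝ) • killingField (m := m) ξ x = XH x := by
      rw [hVξ, hXHeq, Finset.smul_sum]
      simp only [smul_smul]
    rw [hXH0] at h
    exact (smul_eq_zero.1 h).resolve_left two_ne_zero
  have hμd (i : Fin k) : MDifferentiableAt (𝓡 m) 𝓘(ℝ, ℝ) (fun z => 2 * μ z (b i)) x :=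
    mdifferentiableAt_const.mul ((hμ.contMDiff_moment (b i)).mdifferentiable (by simp) x)
  have hXHd : MDiffFieldAt XH x := by
    rw [hXHeq]
    exact MDifferentiableAt.sum_section fun i _ => (hμd i).smul_section (hVd (b i))
  have hL (v : TangentSpace (𝓡 m) x) :
      cov (killingField ξ) x v = ∑ i, μ x (b i) • cov (killingField (b i)) x v := by
    rw [hVξ]
    refine (cov_sum_smul cov Finset.univ (f := fun i _ => μ x (b i))
      (fun i => mdifferentiableAt_const) (fun i => hVd (b i)) v).trans ?_
    refine Finset.sum_congr rfl fun i _ => ?_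
    rw [mvfderiv_const]
    simp
  have hD (v : TangentSpace (𝓡 m) x) :
      cov XH x v = ∑ i, (2 * inner ℝ (J x (killingField (b i) x)) v) • killingField (b i) x
        + (2 : ℝ) • cov (killingField ξ) x v := by
    rw [hXHeq]
    refine (cov_sum_smul cov Finset.univ hμd (fun i => hVd (b i)) v).trans ?_
    rw [hL, Finset.smul_sum, ← Finset.sum_add_distrib]
    refine Finset.sum_congr rfl fun i _ => ?_
    have h1 : mvfderiv (𝓡 m) (fun z => 2 * μ z (b i)) x v
        = 2 * inner ℝ (J x (killingField (b i) x)) v := by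
      rw [hin, hμ.moment (b i) x v]
      have h2 := mvfderiv_mul (mdifferentiableAt_const (c := (2 : ℝ)))
        ((hμ.contMDiff_moment (b i)).mdifferentiable (by simp) x)
      refine (congrArg (fun T => T v) h2).trans ?_
      rw [mvfderiv_const]
      simp
    rw [h1, add_comm, smul_smul]
  refine ⟨⟨hJ.sq x, fun u v => ?_, hD, fun v => ?_, fun u v => ?_, fun w i => ?_, fun j => ?_⟩, ?_⟩
  · change inner ℝ (J x u) v = -inner ℝ u (J x v)
    rw [hin, hJ.metric_eq, hJ.sq, map_neg, neg_neg]
  · exact cov_killingField_comm cov hJd hμ.preserves_J hV0 v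
  -- `V_ξ` is the Hamiltonian field of `μ(ξ)`, so this form is the Hessian of that function.
  · change inner ℝ (J x (cov (killingField ξ) x u)) v = inner ℝ u (J x (cov (killingField ξ) x v))
    have h (u v : TangentSpace (𝓡 m) x) : inner ℝ (J x (cov (killingField ξ) x u)) v = _ :=
      (hin _ _).trans (bilin_cov_eq_hessian cov hΩd (hμ.contMDiff_moment ξ) (hμ.moment ξ)
        (hVd ξ) hV0 u v)
    refine (h u v).trans (Eq.trans ?_ ((h v u).symm.trans (real_inner_comm _ _)))
    exact (contDiffAt_chart ((hμ.contMDiff_moment ξ x).of_le two_le_smooth)).isSymmSndFDerivAt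
      (by simp) u v
  -- The function `Ω(V_ξ, V_i)` is identically zero, and at a zero of `V_ξ` its derivative is
  -- `Ω(∇V_ξ, V_i)`.
  · change inner ℝ (J x (cov (killingField ξ) x w)) (killingField (b i) x) = 0
    rw [hin, ← mvfderiv_bilin_of_eq_zero cov hΩd (hVd ξ) (hVd (b i)) hV0 w]
    simp only [hμ.bilin_killingField_killingField, mvfderiv_const]
    rfl
  · change J x (cov XH x (e j)) = (2 * a j) • e j
    refine InnerProductSpace.ext_inner_right_basis e.toBasis fun i => ?_
    rw [e.coe_toBasis, inner_smul_left, e.inner_eq_ite]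
    refine (hin _ _).trans ((bilin_cov_eq_hessian cov hΩd hH hXH hXHd hXH0 _ _).trans
      ((hy.fderiv_fderiv hH j i).trans ?_))
    split_ifs <;> simp
  · ext v
    exact cov_clm_apply_of_eq_zero cov hJd hXHd hXH0 v

end Critical

end SpincBochner

theorem lemma2p2 {m k : ℕ}
    -- a closed manifold with a symplectic form, a compatible almost complex structure, the
    -- associated Riemannian metric and its Levi-Civita connection
    {M : Type*} [TopologicalSpace M] [T2Space M] [CompactSpace M]
    [ChartedSpace (EuclideanSpace ℝ (Fin m)) M] [IsManifold (𝓡 m) ∞ M]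
    [RiemannianBundle (fun x : M => TangentSpace (𝓡 m) x)]
    [IsContMDiffRiemannianBundle (𝓡 m) ∞ (EuclideanSpace ℝ (Fin m))
      (fun x : M => TangentSpace (𝓡 m) x)]
    (Ω : Π x : M, TangentSpace (𝓡 m) x →L[ℝ] TangentSpace (𝓡 m) x →L[ℝ] ℝ)
    (hΩ : IsSymplecticForm Ω)
    (J : Π x : M, TangentSpace (𝓡 m) x →L[ℝ] TangentSpace (𝓡 m) x)
    (hJ : IsCompatibleAlmostComplex Ω J)
    (cov : CovariantDerivative (𝓡 m) (EuclideanSpace ℝ (Fin m))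
      (fun x : M => TangentSpace (𝓡 m) x))
    (hcov : IsLeviCivita cov)
    -- a Hamiltonian action of a compact connected Abelian Lie group
    {G : Type*} [TopologicalSpace G] [T2Space G] [CompactSpace G] [ConnectedSpace G]
    [ChartedSpace (EuclideanSpace ℝ (Fin k)) G] [CommGroup G] [LieGroup (𝓡 k) ∞ G]
    [MulAction G M] [ContMDiffSMul (𝓡 k) (𝓡 m) ∞ G M]
    (μ : M → Module.Dual ℝ (GroupLieAlgebra (𝓡 k) G))
    (hμ : IsHamiltonianAction Ω J μ)
    -- an invariant metric on the Lie algebra, and an orthonormal basis of the Lie algebra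
    (B : LinearMap.BilinForm ℝ (GroupLieAlgebra (𝓡 k) G)) (hB : IsAdInvariantMetric B)
    (b : Module.Basis (Fin k) ℝ (GroupLieAlgebra (𝓡 k) G))
    (hb : ∀ i j, B (b i) (b j) = if i = j then 1 else 0)
    -- the Hamiltonian vector field of the norm square of the moment map
    (XH : Π x : M, TangentSpace (𝓡 m) x)
    (hXH : IsHamiltonianVectorField Ω (momentNormSq b μ) XH)
    -- a critical point outside the zero set of the moment map
    (x : M) (hx : mvfderiv (𝓡 m) (momentNormSq b μ) x = 0) (hμx : μ x ≠ 0)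
    (e : OrthonormalBasis (Fin m) ℝ (TangentSpace (𝓡 m) x))
    (y : M → EuclideanSpace ℝ (Fin m)) (a : Fin m → ℝ)
    (hy : HasDiagonalExpansion (momentNormSq b μ) x e y a)
    -- the degree, and the fibre of the Hermitian coefficient bundle
    (p : ℕ) (W : Type*) [NormedAddCommGroup W] [InnerProductSpace ℂ W] :
    BoundedBelow (J x).toLinearMap (hJ.sq x) p
      (bochnerTerm J hJ.sq cov XH (fun i => killingField (b i)) x e p W)
      (-∑ j, |a j|) := by
  obtain ⟨h, hDJ⟩ := isMomentLinearization hΩ hJ cov hμ b hXH hx hy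
  exact h.boundedBelow (hJ.sq x) hDJ p
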